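/- Let $a,d,e\in\mathbb R$ with $d<0$ be such that $P_6(x,y)=xy^2+ay-dx-e$ is irreducible in $\mathbb R[x,y]$, let $C=\mathcal Z(P_6)\subseteq\mathbb R^2$ be its real zero set, $I$ the vanishing ideal of $C$, $\mathbb R[C]=\mathbb R[x,y]/I$ with total ring of fractions $Q(\mathbb R[C])$, and for $m\ge 0$ let $\mathbb R[x,y]_{\le m}$ be the space of polynomials of total degree at most $m$, $I_{\le m}=I\cap\mathbb R[x,y]_{\le m}$, and $\mathbb R[C]_{\le m}$ the image of $\mathbb R[x,y]_{\le m}$ in $\mathbb R[C]$. Let $k\ge 1$ be an integer and put, in $\mathbb R[C]$, $$\mathcal B_k=\{x^k,x^{k-1},x^{k-1}y,\dots,x,xy,1,y,\dots,y^k\},\qquad \widetilde{\mathcal B}_k=\{x^ky,x^{k-1},x^{k-1}y,\dots,x,xy,1,y,\dots,y^k\},$$ $$V^{(k)}=\operatorname{Lin}\widetilde{\mathcal B}_k\subseteq Q(\mathbb R[C]),\qquad U=\operatorname{Lin}(\mathcal B_k\setminus\{y^k\}),\qquad W=\operatorname{Lin}(\widetilde{\mathcal B}_k\setminus\{y^k\}).$$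 (One has $gh\in\mathbb R[C]_{\le 2k}$ for all $g,h\in V^{(k)}$.) Let $L:\mathbb R[x,y]_{\le 2k}\to\mathbb R$ be a linear functional, and let $\overline L(f,g)=L(fg)$ on $\mathbb R[x,y]_{\le k}$. If $L$ vanishes on $I_{\le 2k}$, let $L_C:\mathbb R[C]_{\le 2k}\to\mathbb R$ be the induced functional, and define the bilinear forms $\overline L_C(f,g)=L_C(fg)$ on $\mathbb R[C]_{\le k}$ and $\overline L_{C,V^{(k)},1}(g,h)=L_C(gh)$ on $V^{(k)}$. Suppose that $L$ is $C$-singular, that is, $L$ vanishes on $I_{\le 2k}$, and $\ker\overline L\ne I_{\le k}$ or $\ker\overline L_{C,V^{(k)},1}\ne\{0\}$. Then the following are equivalent: 1. $L$ is a $C$-moment functional, that is, there is a (positive) Borel measure $\mu$ supported on $C$ such that every $f\in\mathbb R[x,y]_{\le 2k}$ is $\mu$-integrable and $L(f)=\int_C f\,d\mu$. 2. $L_C$ is square positive ($L_C(f^2)\ge 0$ for all $f\in\mathbb R[C]_{\le k}$) and $(V^{(k)},1)$-locally square positive ($L_C(g^2)\ge 0$ for all $g\in V^{(k)}$), and at least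 one of the following holds: (a) $\operatorname{rank}\overline L_C=\operatorname{rank}\big(\overline L_C|_U\big)$; (b) $\operatorname{rank}\overline L_{C,V^{(k)},1}=\operatorname{rank}\big(\overline L_{C,V^{(k)},1}|_W\big)$. -/

import Mathlib

open MvPolynomial MeasureTheory

noncomputable section

namespace CubicTMP

/-- The space `ℝ[x,y]_{≤ m}` of bivariate polynomials of total degree at most `m`
(`x = X 0`, `y = X 1`). -/
abbrev PolyLE (m : ℕ) : Submodule ℝ (MvPolynomial (Fin 2) ℝ) :=
  restrictTotalDegree (Fin 2) ℝ m

/-- The real zero set `𝒵(P) ⊆ ℝ²`. -/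
def zeroSet (P : MvPolynomial (Fin 2) ℝ) : Set (Fin 2 → ℝ) :=
  {v | eval v P = 0}

/-- `L` is a `K`-moment functional: it is integration against a (positive) Borel measure
supported on `K`. -/
def IsMomentFunctional (K : Set (Fin 2 → ℝ)) {m : ℕ} (L : PolyLE m →ₗ[ℝ] ℝ) : Prop :=
  ∃ μ : Measure (Fin 2 → ℝ), μ Kᶜ = 0 ∧
    ∀ f : PolyLE m, Integrable (fun v => eval v (f : MvPolynomial (Fin 2) ℝ)) μ ∧
      L f = ∫ v in K, eval v (f : MvPolynomial (Fin 2) ℝ) ∂μ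

/-- The ring `ℝ[C] = ℝ[x,y] / I` of polynomial functions on `C`, where `I` is the vanishing ideal
of `C`. -/
abbrev CoordRing (C : Set (Fin 2 → ℝ)) : Type :=
  MvPolynomial (Fin 2) ℝ ⧸ vanishingIdeal ℝ C

/-- The restriction map `ℝ[x,y] → ℝ[C]`. -/
abbrev restr (C : Set (Fin 2 → ℝ)) : MvPolynomial (Fin 2) ℝ →ₐ[ℝ] CoordRing C :=
  Ideal.Quotient.mkₐ ℝ (vanishingIdeal ℝ C)

/-- `ℝ[C]_{≤ m}`, the image of `ℝ[x,y]_{≤ m}` in `ℝ[C]`. -/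
def CoordLE (C : Set (Fin 2 → ℝ)) (m : ℕ) : Submodule ℝ (CoordRing C) :=
  (PolyLE m).map (restr C).toLinearMap

/-- The total ring of fractions `Q(ℝ[C])`. -/
abbrev TotalFrac (C : Set (Fin 2 → ℝ)) : Type := FractionRing (CoordRing C)

/-- The embedding `ℝ[C] ⊆ Q(ℝ[C])`, as a linear map. -/
abbrev toFrac (C : Set (Fin 2 → ℝ)) : CoordRing C →ₗ[ℝ] TotalFrac C :=
  (IsScalarTower.toAlgHom ℝ (CoordRing C) (TotalFrac C)).toLinearMap

theorem toFrac_injective (C : Set (Fin 2 → ℝ)) : Function.Injective (toFrac C) :=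
  IsFractionRing.injective (CoordRing C) (TotalFrac C)

theorem restr_mem {C : Set (Fin 2 → ℝ)} {m : ℕ} {p : MvPolynomial (Fin 2) ℝ}
    (hp : p ∈ PolyLE m) : restr C p ∈ CoordLE C m :=
  Submodule.mem_map_of_mem hp

theorem polyLE_mul_mem {k : ℕ} {p q : MvPolynomial (Fin 2) ℝ}
    (hp : p ∈ PolyLE k) (hq : q ∈ PolyLE k) : p * q ∈ PolyLE (2 * k) := by
  rw [mem_restrictTotalDegree] at *
  exact (totalDegree_mul p q).trans (by omega)

theorem coordLE_mul_mem {C : Set (Fin 2 → ℝ)} {k : ℕ} {f g : CoordRing C}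
    (hf : f ∈ CoordLE C k) (hg : g ∈ CoordLE C k) : f * g ∈ CoordLE C (2 * k) := by
  obtain ⟨p, hp, rfl⟩ := hf
  obtain ⟨q, hq, rfl⟩ := hg
  exact ⟨p * q, polyLE_mul_mem hp hq, map_mul (restr C) p q⟩

/-- The bilinear form `L̄(f,g) = L(fg)` on `ℝ[x,y]_{≤ k}`. -/
def polyForm {k : ℕ} (L : PolyLE (2 * k) →ₗ[ℝ] ℝ) : LinearMap.BilinForm ℝ (PolyLE k) :=
  LinearMap.mk₂ ℝ (fun f g => L ⟨(f : MvPolynomial (Fin 2) ℝ) * g, polyLE_mul_mem f.2 g.2⟩)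
    (fun f₁ f₂ g => by rw [← map_add]; congr 1; ext1; simp [add_mul])
    (fun c f g => by rw [← map_smul]; congr 1; ext1; simp)
    (fun f g₁ g₂ => by rw [← map_add]; congr 1; ext1; simp [mul_add])
    (fun c f g => by rw [← map_smul]; congr 1; ext1; simp)

/-- `L_C` is well defined: `L` vanishes on `I_{≤ m}`. -/
def Descends (C : Set (Fin 2 → ℝ)) {m : ℕ} (L : PolyLE m →ₗ[ℝ] ℝ) : Prop :=
  ∀ p : PolyLE m, (p : MvPolynomial (Fin 2) ℝ) ∈ vanishingIdeal ℝ C → L p = 0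

theorem Descends.eq_of_restr_eq {C : Set (Fin 2 → ℝ)} {m : ℕ} {L : PolyLE m →ₗ[ℝ] ℝ}
    (h : Descends C L) {p q : PolyLE m}
    (hpq : restr C (p : MvPolynomial (Fin 2) ℝ) = restr C (q : MvPolynomial (Fin 2) ℝ)) :
    L p = L q := by
  rw [← sub_eq_zero, ← map_sub]
  exact h _ (Ideal.Quotient.eq.mp hpq)

/-- A representative in `ℝ[x,y]_{≤ m}` of an element of `ℝ[C]_{≤ m}`. -/
def lift {C : Set (Fin 2 → ℝ)} {m : ℕ} (f : CoordLE C m) : PolyLE m :=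
  ⟨f.2.choose, f.2.choose_spec.1⟩

theorem restr_lift {C : Set (Fin 2 → ℝ)} {m : ℕ} (f : CoordLE C m) :
    restr C (lift f : MvPolynomial (Fin 2) ℝ) = (f : CoordRing C) :=
  f.2.choose_spec.2

/-- The induced functional `L_C : ℝ[C]_{≤ m} → ℝ`, `L_C(f + I) = L(f)`. -/
def induced {C : Set (Fin 2 → ℝ)} {m : ℕ} (L : PolyLE m →ₗ[ℝ] ℝ) (h : Descends C L) :
    CoordLE C m →ₗ[ℝ] ℝ where
  toFun f := L (lift f)
  map_add' f g := by
    rw [← map_add]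
    apply h.eq_of_restr_eq
    rw [restr_lift, Submodule.coe_add, Submodule.coe_add, map_add, restr_lift, restr_lift]
  map_smul' c f := by
    rw [RingHom.id_apply, ← map_smul]
    apply h.eq_of_restr_eq
    rw [restr_lift, Submodule.coe_smul, Submodule.coe_smul, map_smul, restr_lift]

theorem induced_apply {C : Set (Fin 2 → ℝ)} {m : ℕ} (L : PolyLE m →ₗ[ℝ] ℝ) (h : Descends C L)
    (p : PolyLE m) : induced L h ⟨restr C p, restr_mem p.2⟩ = L p :=
  h.eq_of_restr_eq (restr_lift _)

/-- The bilinear form `L̄_C(f,g) = L_C(fg)` on `ℝ[C]_{≤ k}`. -/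
def coordForm {C : Set (Fin 2 → ℝ)} {k : ℕ} (LC : CoordLE C (2 * k) →ₗ[ℝ] ℝ) :
    LinearMap.BilinForm ℝ (CoordLE C k) :=
  LinearMap.mk₂ ℝ (fun f g => LC ⟨(f : CoordRing C) * g, coordLE_mul_mem f.2 g.2⟩)
    (fun f₁ f₂ g => by rw [← map_add]; congr 1; ext1; simp [add_mul])
    (fun c f g => by rw [← map_smul]; congr 1; ext1; exact smul_mul_assoc c _ _)
    (fun f g₁ g₂ => by rw [← map_add]; congr 1; ext1; simp [mul_add])
    (fun c f g => by rw [← map_smul]; congr 1; ext1; exact mul_smul_comm c _ _)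

/-- The condition `f g h ∈ ℝ[C]_{≤ 2k}` for all `g, h ∈ V`, under which the localizing form of
the pair `(V, f)` makes sense. -/
def Admissible {C : Set (Fin 2 → ℝ)} (k : ℕ) (V : Submodule ℝ (TotalFrac C))
    (f : TotalFrac C) : Prop :=
  ∀ g ∈ V, ∀ h ∈ V, f * (g * h) ∈ (CoordLE C (2 * k)).map (toFrac C)

/-- The localizing form `L̄_{C,V,f}(g,h) = L_C(f g h)` on `V ⊆ Q(ℝ[C])`. -/
def locForm {C : Set (Fin 2 → ℝ)} {k : ℕ} (LC : CoordLE C (2 * k) →ₗ[ℝ] ℝ)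
    {V : Submodule ℝ (TotalFrac C)} {f : TotalFrac C} (hV : Admissible k V f) :
    LinearMap.BilinForm ℝ V :=
  LinearMap.mk₂ ℝ
    (fun g h => LC (((CoordLE C (2 * k)).equivMapOfInjective (toFrac C) (toFrac_injective C)).symm
      ⟨f * ((g : TotalFrac C) * h), hV g g.2 h h.2⟩))
    (fun g₁ g₂ h => by
      rw [← map_add, ← map_add]; congr 2; ext1; simp [add_mul, mul_add])
    (fun c g h => by rw [← map_smul, ← map_smul]; congr 2; ext1; simp)
    (fun g h₁ h₂ => by rw [← map_add, ← map_add]; congr 2; ext1; simp [mul_add])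
    (fun c g h => by rw [← map_smul, ← map_smul]; congr 2; ext1; simp)

theorem locForm_apply {C : Set (Fin 2 → ℝ)} {k : ℕ} (LC : CoordLE C (2 * k) →ₗ[ℝ] ℝ)
    {V : Submodule ℝ (TotalFrac C)} {f : TotalFrac C} (hV : Admissible k V f) (g h : V)
    (r : CoordLE C (2 * k)) (hr : toFrac C r = f * ((g : TotalFrac C) * h)) :
    locForm LC hV g h = LC r := by
  change LC _ = LC r
  congr 1
  rw [LinearEquiv.symm_apply_eq]
  ext1
  exact hr.symm

/-- `L_C(f²) ≥ 0` for all `f ∈ ℝ[C]_{≤ k}`. -/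
def SquarePositive {C : Set (Fin 2 → ℝ)} {k : ℕ} (LC : CoordLE C (2 * k) →ₗ[ℝ] ℝ) : Prop :=
  ∀ f : CoordLE C k, 0 ≤ coordForm LC f f

/-- `L_C(f g²) ≥ 0` for all `g ∈ V`. -/
def LocSquarePositive {C : Set (Fin 2 → ℝ)} {k : ℕ} (LC : CoordLE C (2 * k) →ₗ[ℝ] ℝ)
    {V : Submodule ℝ (TotalFrac C)} {f : TotalFrac C} (hV : Admissible k V f) : Prop :=
  ∀ g : V, 0 ≤ locForm LC hV g g

/-- `L` is `C`-nonsingular with respect to the pair `(V, f)`: `ker L̄ = I_{≤ k}` and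
`ker L̄_{C,V,f} = {0}`. -/
def Nonsingular {C : Set (Fin 2 → ℝ)} {k : ℕ} (L : PolyLE (2 * k) →ₗ[ℝ] ℝ) (h : Descends C L)
    {V : Submodule ℝ (TotalFrac C)} {f : TotalFrac C} (hV : Admissible k V f) : Prop :=
  (∀ p : PolyLE k, p ∈ LinearMap.ker (polyForm L) ↔
      (p : MvPolynomial (Fin 2) ℝ) ∈ vanishingIdeal ℝ C) ∧
    LinearMap.ker (locForm (induced L h) hV) = ⊥

/-- `L` is `C`-singular with respect to `(V, f)`: `L_C` is well defined, but `L` is not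
`C`-nonsingular. -/
def Singular {C : Set (Fin 2 → ℝ)} {k : ℕ} (L : PolyLE (2 * k) →ₗ[ℝ] ℝ)
    {V : Submodule ℝ (TotalFrac C)} {f : TotalFrac C} (hV : Admissible k V f) : Prop :=
  ∃ h : Descends C L, ¬ Nonsingular L h hV

theorem Singular.descends {C : Set (Fin 2 → ℝ)} {k : ℕ} {L : PolyLE (2 * k) →ₗ[ℝ] ℝ}
    {V : Submodule ℝ (TotalFrac C)} {f : TotalFrac C} {hV : Admissible k V f}
    (h : Singular L hV) : Descends C L :=
  h.1

/-- The rank of the restriction `B|_U` of a bilinear form on `V` to `V ∩ U`; below always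
`U ⊆ V`. -/
def rankOn {E : Type} [AddCommGroup E] [Module ℝ E] {V : Submodule ℝ E}
    (B : LinearMap.BilinForm ℝ V) (U : Submodule ℝ E) : Cardinal :=
  LinearMap.rank (B.restrict (U.submoduleOf V))

/-- `P₆ = x y² + a y - d x - e`. -/
def P6 (a d e : ℝ) : MvPolynomial (Fin 2) ℝ :=
  X 0 * X 1 ^ 2 + C a * X 1 - C d * X 0 - C e

/-- The curve `𝒵(P₆)`. -/
abbrev curve6 (a d e : ℝ) : Set (Fin 2 → ℝ) := zeroSet (P6 a d e)

/-- The monomial `xⁱ yʲ` in `ℝ[C]`. -/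
def mon (C : Set (Fin 2 → ℝ)) (i j : ℕ) : CoordRing C :=
  restr C (X 0 ^ i * X 1 ^ j)

/-- `{x^{k-1}, x^{k-1}y, …, x, xy, 1, y, …, y^k} ⊆ ℝ[C]`. -/
def basisCore (C : Set (Fin 2 → ℝ)) (k : ℕ) : Set (CoordRing C) :=
  {b | ∃ i, 1 ≤ i ∧ i ≤ k - 1 ∧ (b = mon C i 0 ∨ b = mon C i 1)} ∪ {b | ∃ j ≤ k, b = mon C 0 j}

/-- `ℬ_k = {x^k, x^{k-1}, x^{k-1}y, …, x, xy, 1, y, …, y^k}`. -/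
def basisB (C : Set (Fin 2 → ℝ)) (k : ℕ) : Set (CoordRing C) :=
  {mon C k 0} ∪ basisCore C k

/-- `ℬ̃_k = {x^k y, x^{k-1}, x^{k-1}y, …, x, xy, 1, y, …, y^k}`, that is, `ℬ_k` with `x^k`
replaced by `x^k y`. -/
def basisBt (C : Set (Fin 2 → ℝ)) (k : ℕ) : Set (CoordRing C) :=
  {mon C k 1} ∪ basisCore C k

/-- `V^{(k)} = Lin ℬ̃_k ⊆ Q(ℝ[C])`. -/
def Vk (C : Set (Fin 2 → ℝ)) (k : ℕ) : Submodule ℝ (TotalFrac C) :=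
  Submodule.span ℝ (toFrac C '' basisBt C k)

/-- `U = Lin (ℬ_k \ {y^k}) ⊆ ℝ[C]_{≤ k}`. -/
def Uk (C : Set (Fin 2 → ℝ)) (k : ℕ) : Submodule ℝ (CoordRing C) :=
  Submodule.span ℝ (basisB C k \ {mon C 0 k})

/-- `W = Lin (ℬ̃_k \ {y^k}) ⊆ V^{(k)}`. -/
def Wk (C : Set (Fin 2 → ℝ)) (k : ℕ) : Submodule ℝ (TotalFrac C) :=
  Submodule.span ℝ (toFrac C '' (basisBt C k \ {mon C 0 k}))

theorem mon_mul (C : Set (Fin 2 → ℝ)) (i j i' j' : ℕ) :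
    mon C i j * mon C i' j' = mon C (i + i') (j + j') := by
  unfold mon
  rw [← map_mul]
  congr 1
  ring

theorem mon_mem (C : Set (Fin 2 → ℝ)) {i j m : ℕ} (h : i + j ≤ m) : mon C i j ∈ CoordLE C m := by
  apply restr_mem
  rw [mem_restrictTotalDegree]
  refine (totalDegree_mul _ _).trans (le_trans (add_le_add (totalDegree_pow _ _)
    (totalDegree_pow _ _)) ?_)
  simpa using h

theorem mon_reduce (a d e : ℝ) (i j : ℕ) :
    mon (curve6 a d e) (i + 1) (j + 2) = (-a) • mon (curve6 a d e) i (j + 1)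
      + d • mon (curve6 a d e) (i + 1) j + e • mon (curve6 a d e) i j := by
  unfold mon
  rw [← map_smul, ← map_smul, ← map_smul, ← map_add, ← map_add]
  apply Ideal.Quotient.eq.mpr
  intro v hv
  have h0 : eval v (P6 a d e) = 0 := hv
  simp only [P6, map_sub, map_add, map_mul, map_pow, eval_X, eval_C] at h0
  simp only [map_sub, map_add, map_mul, map_pow, map_smul, aeval_X, smul_eq_mul]
  linear_combination (v 0 ^ i * v 1 ^ j) * h0

theorem mon_reduce_mem (a d e : ℝ) {i j m : ℕ} (hi : 1 ≤ i) (hj : 2 ≤ j) (h : i + j ≤ m + 2) :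
    mon (curve6 a d e) i j ∈ CoordLE (curve6 a d e) m := by
  obtain ⟨i, rfl⟩ := Nat.exists_eq_add_of_le' hi
  obtain ⟨j, rfl⟩ := Nat.exists_eq_add_of_le' hj
  rw [mon_reduce]
  exact add_mem (add_mem (Submodule.smul_mem _ _ (mon_mem _ (by omega)))
    (Submodule.smul_mem _ _ (mon_mem _ (by omega)))) (Submodule.smul_mem _ _ (mon_mem _ (by omega)))

theorem exists_mon_of_mem_basisBt {C : Set (Fin 2 → ℝ)} {k : ℕ} (hk : 1 ≤ k) {b : CoordRing C}
    (hb : b ∈ basisBt C k) :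
    ∃ i j, b = mon C i j ∧ ((i = k ∧ j = 1) ∨ (i + j ≤ k ∧ (j = 0 → i < k))) := by
  rcases hb with rfl | ⟨i, hi, hik, rfl | rfl⟩ | ⟨j, hj, rfl⟩
  · exact ⟨k, 1, rfl, by omega⟩
  · exact ⟨i, 0, rfl, by omega⟩
  · exact ⟨i, 1, rfl, by omega⟩
  · exact ⟨0, j, rfl, by omega⟩

/-- On `𝒵(P₆)` all products of two elements of `V^{(k)}` lie in `ℝ[C]_{≤ 2k}`. -/
theorem admissible_Vk (a d e : ℝ) {k : ℕ} (hk : 1 ≤ k) :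
    Admissible k (Vk (curve6 a d e) k) 1 := by
  have key : Submodule.span ℝ (basisBt (curve6 a d e) k) *
      Submodule.span ℝ (basisBt (curve6 a d e) k) ≤ CoordLE (curve6 a d e) (2 * k) := by
    rw [Submodule.span_mul_span, Submodule.span_le]
    rintro _ ⟨b, hb, c, hc, rfl⟩
    obtain ⟨i, j, rfl, h⟩ := exists_mon_of_mem_basisBt hk hb
    obtain ⟨i', j', rfl, h'⟩ := exists_mon_of_mem_basisBt hk hc
    simp only [mon_mul, SetLike.mem_coe]
    by_cases hle : i + i' + (j + j') ≤ 2 * k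
    · exact mon_mem _ hle
    · exact mon_reduce_mem a d e (by omega) (by omega) (by omega)
  intro g hg h hh
  rw [Vk, ← Submodule.map_span] at hg hh
  obtain ⟨g, hg, rfl⟩ := hg
  obtain ⟨h, hh, rfl⟩ := hh
  exact ⟨g * h, key (Submodule.mul_mem_mul hg hh), by simp⟩

theorem Uk_le (C : Set (Fin 2 → ℝ)) {k : ℕ} : Uk C k ≤ CoordLE C k := by
  refine Submodule.span_le.mpr ?_
  rintro b ⟨rfl | ⟨i, hi, hik, rfl | rfl⟩ | ⟨j, hj, rfl⟩, -⟩ <;> exact mon_mem C (by omega)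

theorem Wk_le (C : Set (Fin 2 → ℝ)) (k : ℕ) : Wk C k ≤ Vk C k :=
  Submodule.span_mono (Set.image_mono Set.sdiff_subset)

end CubicTMP

end

open CubicTMP

noncomputable section

/-! Since d < 0, the curve is the graph x = (e - a t)/(t² - d) over y = t. A function of degree at
most m on it is q(t)/(t² - d)^m with deg q ≤ 3m. At the complex point n = i√(-d) there is one
further condition: q(n) is a real multiple of w^m, where w = e - a n. Irreducibility gives w ≠ 0.
Numerators of degree at most 3k with q(n) ∈ ℝ w^k describe Lin ℬ_k, and those with q(n) ∈ ℝ w^k n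
describe V^(k) (`span_basisE_le`, `exists_isNumerator_basisE`).

A nonnegative numerator of a function of degree at most 2k is f₀² + g₀². The squares of f₀(n)/w^k
and g₀(n)/w^k have a real sum, so a rotation of (f₀, g₀) makes the first value real and the second
purely imaginary. The function is thus a square from Lin ℬ_k plus a square from V^(k)
(`exists_eq_sq_add_sq`). The two positivity conditions therefore make L_C nonnegative on nonnegative
functions. Riesz extension then gives a measure on the circle of directions (re : im), with t =
re/im (`exists_measure_circle`). This measure comes from the curve once it has no mass at t = ∞.

For a semidefinite form, either rank condition says that some g outside the hyperplane without y^k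
has L_C(g²) = 0. Its numerator has exact degree 3k, hence is nonzero at infinity, so the mass there
vanishes (`isMomentFunctional_of_sq_eq_zero`). Conversely, singularity gives a nonzero g with
L_C(g²) = 0. Raising the degree of its numerator to exactly 3k preserves its zeros on the curve, so
for a moment functional the new square is also annihilated (`exists_notMem_of_ne_zero`). -/

/-! ### Sums of two squares of real polynomials -/

theorem Polynomial.X_sub_C_sq_dvd_of_nonneg {q : Polynomial ℝ} (h : ∀ t, 0 ≤ q.eval t) {r : ℝ}
    (hr : q.eval r = 0) : (Polynomial.X - Polynomial.C r) ^ 2 ∣ q := by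
  by_cases hq : q = 0
  · simp [hq]
  have hmin : IsLocalMin (fun t => q.eval t) r := Filter.Eventually.of_forall fun t => by
    simpa [hr] using h t
  have hd : q.derivative.IsRoot r := by
    have := hmin.deriv_eq_zero
    rwa [Polynomial.deriv] at this
  have := (Polynomial.one_lt_rootMultiplicity_iff_isRoot hq).2 ⟨hr, hd⟩
  exact (Polynomial.le_rootMultiplicity_iff hq).1 this

/-- Away from r the square can be divided out; the point r itself follows by density and continuity.
-/
theorem Polynomial.nonneg_of_X_sub_C_sq_mul {q : Polynomial ℝ} {r : ℝ}
    (h : ∀ t, 0 ≤ ((Polynomial.X - Polynomial.C r) ^ 2 * q).eval t) (t : ℝ) : 0 ≤ q.eval t := by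
  have hcl : IsClosed {t : ℝ | 0 ≤ q.eval t} := isClosed_le continuous_const q.continuous
  have hsub : ({r}ᶜ : Set ℝ) ⊆ {t : ℝ | 0 ≤ q.eval t} := by
    intro t ht
    have h1 := h t
    simp only [Polynomial.eval_mul, Polynomial.eval_pow, Polynomial.eval_sub, Polynomial.eval_X,
      Polynomial.eval_C] at h1
    have : 0 < (t - r) ^ 2 := by
      have : t - r ≠ 0 := sub_ne_zero.2 ht
      positivity
    exact nonneg_of_mul_nonneg_right h1 this
  have := hcl.closure_subset_iff.2 hsub
  rw [(dense_compl_singleton r).closure_eq] at this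
  exact this trivial

/-- A univariate real polynomial that is nonnegative on the line is a sum of two squares. -/
theorem Polynomial.exists_eq_sq_add_sq_of_nonneg (q : Polynomial ℝ) (h : ∀ t, 0 ≤ q.eval t) :
    ∃ f g : Polynomial ℝ, q = f ^ 2 + g ^ 2 := by
  induction hn : q.natDegree using Nat.strong_induction_on generalizing q with
  | _ n ih =>
  by_cases h0 : q.natDegree = 0
  · obtain ⟨c, rfl⟩ := Polynomial.natDegree_eq_zero.1 h0
    refine ⟨Polynomial.C √c, 0, ?_⟩
    have hc : 0 ≤ c := by simpa using h 0
    rw [← Polynomial.C_pow, Real.sq_sqrt hc]; simp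
  obtain ⟨z, hz⟩ := IsAlgClosed.exists_aeval_eq_zero ℂ q
    (fun hd => h0 (Polynomial.natDegree_eq_of_degree_eq_some hd))
  by_cases him : z.im = 0
  · have hr : q.eval z.re = 0 := by
      have hz' : z = algebraMap ℝ ℂ z.re := by apply Complex.ext <;> simp [him]
      rw [hz', Polynomial.aeval_algebraMap_apply] at hz
      simpa using hz
    obtain ⟨q', rfl⟩ := Polynomial.X_sub_C_sq_dvd_of_nonneg h hr
    have hq' : q' ≠ 0 := by rintro rfl; simp at h0
    have hm : ((Polynomial.X - Polynomial.C z.re) ^ 2).Monic :=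
      (Polynomial.monic_X_sub_C _).pow 2
    have hdeg : ((Polynomial.X - Polynomial.C z.re) ^ 2 * q').natDegree = 2 + q'.natDegree := by
      rw [hm.natDegree_mul' hq', Polynomial.natDegree_pow, Polynomial.natDegree_X_sub_C]
    obtain ⟨f, g, hfg⟩ := ih q'.natDegree (by omega) q' (Polynomial.nonneg_of_X_sub_C_sq_mul h) rfl
    exact ⟨(Polynomial.X - Polynomial.C z.re) * f, (Polynomial.X - Polynomial.C z.re) * g, by
      rw [hfg]; ring⟩
  · obtain ⟨q', rfl⟩ := Polynomial.quadratic_dvd_of_aeval_eq_zero_im_ne_zero q hz him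
    -- The quadratic factor of a nonreal root is itself a sum of two squares, and the two-squares
    -- product identity combines it with the decomposition of the quotient.
    have hp : (Polynomial.X ^ 2 - Polynomial.C (2 * z.re) * Polynomial.X
        + Polynomial.C (‖z‖ ^ 2) : Polynomial ℝ)
        = (Polynomial.X - Polynomial.C z.re) ^ 2 + Polynomial.C z.im ^ 2 := by
      rw [Complex.sq_norm, Complex.normSq_apply]
      simp only [map_mul, map_add, Polynomial.C_ofNat]
      ring
    have hq' : q' ≠ 0 := by rintro rfl; simp at h0
    have hm : (Polynomial.X ^ 2 - Polynomial.C (2 * z.re) * Polynomial.X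
        + Polynomial.C (‖z‖ ^ 2) : Polynomial ℝ).Monic := by monicity!
    have hd : (Polynomial.X ^ 2 - Polynomial.C (2 * z.re) * Polynomial.X
        + Polynomial.C (‖z‖ ^ 2) : Polynomial ℝ).natDegree = 2 := by compute_degree!
    have hdeg := hm.natDegree_mul' hq'
    rw [hd] at hdeg
    have hpos : ∀ t, 0 ≤ q'.eval t := fun t => by
      have h1 := h t
      rw [hp] at h1
      simp only [Polynomial.eval_mul, Polynomial.eval_pow, Polynomial.eval_sub, Polynomial.eval_X,
        Polynomial.eval_C, Polynomial.eval_add] at h1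
      have : 0 < (t - z.re) ^ 2 + z.im ^ 2 := by positivity
      exact nonneg_of_mul_nonneg_right h1 this
    obtain ⟨f, g, hfg⟩ := ih q'.natDegree (by omega) q' hpos rfl
    refine ⟨(Polynomial.X - Polynomial.C z.re) * f + Polynomial.C z.im * g,
      (Polynomial.X - Polynomial.C z.re) * g - Polynomial.C z.im * f, ?_⟩
    rw [hp, hfg]; ring

/-- Leading terms cannot cancel: the coefficient in twice the larger degree is a sum of two real
squares, not both zero. -/
theorem Polynomial.natDegree_le_of_natDegree_sq_add_sq_le {f g : Polynomial ℝ} {n : ℕ}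
    (h : (f ^ 2 + g ^ 2).natDegree ≤ 2 * n) : f.natDegree ≤ n ∧ g.natDegree ≤ n := by
  suffices hN : max f.natDegree g.natDegree ≤ n by exact max_le_iff.1 hN
  set N := max f.natDegree g.natDegree with hNdef
  have hf : f.natDegree ≤ N := le_max_left _ _
  have hg : g.natDegree ≤ N := le_max_right _ _
  by_contra! hlt
  have h0 : (f ^ 2 + g ^ 2).coeff (2 * N) = 0 :=
    Polynomial.coeff_eq_zero_of_natDegree_lt (by omega)
  rw [Polynomial.coeff_add, Polynomial.coeff_pow_of_natDegree_le hf,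
    Polynomial.coeff_pow_of_natDegree_le hg] at h0
  have hfN : f.coeff N = 0 := by nlinarith [sq_nonneg (f.coeff N), sq_nonneg (g.coeff N)]
  have hgN : g.coeff N = 0 := by nlinarith [sq_nonneg (f.coeff N), sq_nonneg (g.coeff N)]
  rcases max_choice f.natDegree g.natDegree with hm | hm
  · rw [← hNdef] at hm
    rw [hm, Polynomial.coeff_natDegree, Polynomial.leadingCoeff_eq_zero] at hfN
    rw [hfN, Polynomial.natDegree_zero] at hm
    omega
  · rw [← hNdef] at hm
    rw [hm, Polynomial.coeff_natDegree, Polynomial.leadingCoeff_eq_zero] at hgN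
    rw [hgN, Polynomial.natDegree_zero] at hm
    omega

/-- If `α² + β²` is real, a rotation makes the first entry real and the second imaginary. -/
theorem Complex.exists_rotation_of_im_sq_add_sq_eq_zero {α β : ℂ} (h : (α ^ 2 + β ^ 2).im = 0) :
    ∃ c s : ℝ, c ^ 2 + s ^ 2 = 1 ∧ (c * α + s * β).im = 0 ∧ (c * β - s * α).re = 0 := by
  -- The vectors of real parts and of imaginary parts of (α, β) are orthogonal in ℝ². The rotation
  -- turns the real vector to the first axis, or the imaginary one to the second axis if the real
  -- vector is zero.
  have horth : α.re * α.im + β.re * β.im = 0 := by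
    simp [pow_two] at h; linarith
  have norm : ∀ x y : ℝ, ¬ (x = 0 ∧ y = 0) → ∃ ρ : ℝ, ρ ^ 2 * (x ^ 2 + y ^ 2) = 1 := by
    intro x y hxy
    have hpos : 0 < x ^ 2 + y ^ 2 := by
      by_contra! hle
      exact hxy ⟨by nlinarith [sq_nonneg x, sq_nonneg y], by nlinarith [sq_nonneg x, sq_nonneg y]⟩
    refine ⟨(√(x ^ 2 + y ^ 2))⁻¹, ?_⟩
    rw [inv_pow, Real.sq_sqrt hpos.le, inv_mul_cancel₀ hpos.ne']
  by_cases hu : α.re = 0 ∧ β.re = 0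
  · by_cases hv : α.im = 0 ∧ β.im = 0
    · exact ⟨1, 0, by simp, by simp [hv.1], by simp [hu.2]⟩
    · obtain ⟨ρ, hρ⟩ := norm _ _ hv
      refine ⟨ρ * β.im, -(ρ * α.im), by linarith, ?_, ?_⟩
      · simp; ring
      · simp [hu.1, hu.2]
  · obtain ⟨ρ, hρ⟩ := norm _ _ hu
    refine ⟨ρ * α.re, ρ * β.re, by linarith, ?_, ?_⟩
    · simp; linear_combination ρ * horth
    · simp; ring

/-! ### Representing measures on a compact space -/

/-- A functional on a space mapped to continuous functions on a compact space, nonnegative where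
the image is nonnegative, is integration against a finite measure. -/
theorem exists_measure_of_nonneg_on_nonneg {X M : Type*} [TopologicalSpace X] [CompactSpace X]
    [T2Space X] [MeasurableSpace X] [BorelSpace X] [AddCommGroup M] [Module ℝ M]
    (T : M →ₗ[ℝ] C(X, ℝ)) (Λ : M →ₗ[ℝ] ℝ)
    (hΛ : ∀ m, (∀ x, 0 ≤ T m x) → 0 ≤ Λ m) (hpos : ∃ m, ∀ x, 0 < T m x) :
    ∃ ν : Measure X, IsFiniteMeasure ν ∧ ∀ m, Λ m = ∫ x, T m x ∂ν := by
  have hker : ∀ m, T m = 0 → Λ m = 0 := fun m hm => by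
    have h1 := hΛ m (fun x => by simp [hm])
    have h2 := hΛ (-m) (fun x => by simp [hm])
    rw [map_neg] at h2
    linarith
  have hwd : ∀ x : LinearMap.range T, T (Function.surjInv T.surjective_rangeRestrict x) = x :=
    fun x => congrArg Subtype.val (Function.surjInv_eq T.surjective_rangeRestrict x)
  have hval : ∀ m m', T m = T m' → Λ m = Λ m' := fun m m' h => by
    have := hker (m - m') (by rw [map_sub, h, sub_self])
    rw [map_sub] at this
    linarith
  let f : C(X, ℝ) →ₗ.[ℝ] ℝ :=
    { domain := LinearMap.range T
      toFun :=
        { toFun := fun x => Λ (Function.surjInv T.surjective_rangeRestrict x)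
          map_add' := fun x y => by
            rw [← map_add]; apply hval; rw [map_add, hwd, hwd, hwd]; rfl
          map_smul' := fun c x => by
            rw [RingHom.id_apply, ← map_smul]; apply hval; rw [map_smul, hwd, hwd]; rfl } }
  have hf : ∀ m, f ⟨T m, m, rfl⟩ = Λ m := fun m => hval _ _ (hwd _)
  obtain ⟨m₀, hm₀⟩ := hpos
  obtain ⟨δ, hδ, hδm⟩ : ∃ δ : ℝ, 0 < δ ∧ ∀ x, δ ≤ T m₀ x := by
    rcases isEmpty_or_nonempty X with hX | hX
    · exact ⟨1, one_pos, fun x => hX.elim x⟩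
    · obtain ⟨x₀, hx₀⟩ := isCompact_univ.exists_isMinOn Set.univ_nonempty
        (T m₀).continuous.continuousOn
      exact ⟨T m₀ x₀, hm₀ x₀, fun x => hx₀.2 trivial⟩
  -- Multiples of the image of m₀, which is at least δ everywhere, dominate every continuous
  -- function. This is the cofinality that Riesz extension needs; the extended positive functional
  -- is then a measure by Riesz–Markov–Kakutani.
  obtain ⟨G, hG, hGpos⟩ := riesz_extension (PointedCone.positive ℝ C(X, ℝ)) f
    (by
      rintro ⟨_, m, rfl⟩ hx
      rw [hf]
      exact hΛ m hx)
    (by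
      intro y
      refine ⟨⟨T ((‖y‖ / δ) • m₀), _, rfl⟩, ?_⟩
      rw [PointedCone.mem_positive]
      intro x
      have h1 : |y x| ≤ ‖y‖ := y.norm_coe_le_norm x
      have h2 : ‖y‖ ≤ ‖y‖ / δ * T m₀ x := by
        rw [div_mul_eq_mul_div, le_div_iff₀ hδ]
        exact mul_le_mul_of_nonneg_left (hδm x) (norm_nonneg _)
      have h3 := neg_le_of_abs_le h1
      simp
      linarith)
  let P : CompactlySupportedContinuousMap X ℝ →ₗ[ℝ] ℝ :=
    { toFun := fun φ => G φ.toContinuousMap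
      map_add' := fun φ ψ => by rw [← map_add]; rfl
      map_smul' := fun c φ => by rw [RingHom.id_apply, ← map_smul]; rfl }
  let Q : CompactlySupportedContinuousMap X ℝ →ₚ[ℝ] ℝ :=
    PositiveLinearMap.mk₀ P fun φ hφ => hGpos _ hφ
  refine ⟨RealRMK.rieszMeasure Q, inferInstance, fun m => ?_⟩
  have h1 := RealRMK.integral_rieszMeasure Q
    (CompactlySupportedContinuousMap.continuousMapEquiv (T m))
  rw [← hf m, ← hG]
  exact h1.symm

/-! ### Ranks and kernels of bilinear forms -/

/-- If restricting a bilinear form to a proper subspace does not lower its rank, its kernel is not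
contained in that subspace. -/
theorem LinearMap.BilinForm.exists_mem_ker_notMem_of_rank_eq {M : Type} [AddCommGroup M]
    [Module ℝ M] [FiniteDimensional ℝ M] (B : LinearMap.BilinForm ℝ M) {S : Submodule ℝ M}
    (hS : S ≠ ⊤) (h : LinearMap.rank B = LinearMap.rank (B.restrict S)) :
    ∃ g ∈ LinearMap.ker B, g ∉ S := by
  by_contra! hle
  have h1 := LinearMap.finrank_range_add_finrank_ker B
  have h2 := LinearMap.finrank_range_add_finrank_ker (B.restrict S)
  have h3 : Module.finrank ℝ (LinearMap.range B)
      = Module.finrank ℝ (LinearMap.range (B.restrict S)) := congrArg Cardinal.toNat h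
  have h4 : Module.finrank ℝ S < Module.finrank ℝ M := Submodule.finrank_lt hS
  -- A kernel inside S embeds in the kernel of the restriction. With equal ranks, rank–nullity would
  -- make S as large as the whole space.
  have h5 : Module.finrank ℝ (LinearMap.ker B)
      ≤ Module.finrank ℝ (LinearMap.ker (B.restrict S)) := by
    refine LinearMap.finrank_le_finrank_of_injective
      (f := ((Submodule.inclusion hle).restrict (p := ⊤)
        (q := LinearMap.ker (B.restrict S)) ?_).comp Submodule.topEquiv.symm.toLinearMap) ?_
    · rintro ⟨x, hx⟩ -
      rw [LinearMap.mem_ker] at hx ⊢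
      ext y
      exact LinearMap.congr_fun hx y
    · intro x y hxy
      ext
      exact congrArg (fun t => ((t : S) : M)) (congrArg Subtype.val hxy)
  omega

/-- Modulo g every vector lies in S, so restricting the first argument keeps the range. By symmetry
g is also invisible in the second argument, so restricting that one does not enlarge the kernel. -/
theorem LinearMap.BilinForm.rank_eq_rank_restrict {M : Type} [AddCommGroup M]
    [Module ℝ M] (B : LinearMap.BilinForm ℝ M) (hB : B.IsSymm) {S : Submodule ℝ M} {g : M}
    (hg : g ∈ LinearMap.ker B) (hS : ∀ x, ∃ y ∈ S, ∃ r : ℝ, x = y + r • g) :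
    LinearMap.rank B = LinearMap.rank (B.restrict S) := by
  have hr : LinearMap.range B = LinearMap.range (B.domRestrict S) := by
    refine le_antisymm ?_ (LinearMap.range_comp_le_range _ _)
    rintro _ ⟨x, rfl⟩
    obtain ⟨y, hy, r, rfl⟩ := hS x
    refine ⟨⟨y, hy⟩, ?_⟩
    rw [map_add, map_smul, LinearMap.mem_ker.1 hg]
    simp
  have hk : LinearMap.ker (B.domRestrict S) = LinearMap.ker (B.restrict S) := by
    ext x
    rw [LinearMap.mem_ker, LinearMap.mem_ker]
    constructor
    · intro h
      ext y
      exact LinearMap.congr_fun h y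
    · intro h
      ext y
      obtain ⟨y, hy, r, rfl⟩ := hS y
      have h1 : B x y = 0 := LinearMap.congr_fun h ⟨y, hy⟩
      have h2 : B x g = 0 := by
        rw [hB.eq, LinearMap.mem_ker.1 hg]; rfl
      simp [h1, h2]
  unfold LinearMap.rank
  rw [hr, ← (LinearMap.quotKerEquivRange (B.domRestrict S)).rank_eq,
    ← (LinearMap.quotKerEquivRange (B.restrict S)).rank_eq, hk]

/-- Cauchy–Schwarz for a positive semidefinite form. -/
theorem LinearMap.BilinForm.mem_ker_of_apply_self_eq_zero {M : Type*} [AddCommGroup M]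
    [Module ℝ M] (B : LinearMap.BilinForm ℝ M) (hB : B.IsSymm) (hs : ∀ x, 0 ≤ B x x) {g : M}
    (hg : B g g = 0) : g ∈ LinearMap.ker B := by
  rw [LinearMap.mem_ker]
  ext y
  have := B.apply_sq_le_of_symm hs ⟨fun x y => hB.eq x y⟩ g y
  rw [hg, zero_mul] at this
  simpa using pow_eq_zero_iff two_ne_zero |>.1 (le_antisymm this (sq_nonneg _))

/-! ### The curve as a graph over the y-axis -/

namespace CubicTMP

/-- Evaluation of polynomial functions on `C` at a point of `C`. -/
def evalAt {C : Set (Fin 2 → ℝ)} (v : Fin 2 → ℝ) (hv : v ∈ C) : CoordRing C →ₐ[ℝ] ℝ :=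
  Ideal.Quotient.liftₐ (vanishingIdeal ℝ C) (MvPolynomial.aeval v) fun _ hp => hp v hv

theorem evalAt_restr {C : Set (Fin 2 → ℝ)} {v : Fin 2 → ℝ} (hv : v ∈ C)
    (p : MvPolynomial (Fin 2) ℝ) : evalAt v hv (restr C p) = eval v p := by
  change MvPolynomial.aeval v p = _
  rw [MvPolynomial.aeval_eq_eval]

theorem eq_zero_of_evalAt {C : Set (Fin 2 → ℝ)} {f : CoordRing C}
    (h : ∀ v (hv : v ∈ C), evalAt v hv f = 0) : f = 0 := by
  obtain ⟨p, rfl⟩ := Ideal.Quotient.mkₐ_surjective ℝ (vanishingIdeal ℝ C) f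
  exact Ideal.Quotient.eq_zero_iff_mem.2 fun v hv => h v hv

/-- The rational parametrization of `𝒵(P₆)` by the `y`-coordinate. -/
def param (a d e t : ℝ) : Fin 2 → ℝ := ![(e - a * t) / (t ^ 2 - d), t]

variable {a d e : ℝ}

theorem sq_sub_pos (hd : d < 0) (t : ℝ) : 0 < t ^ 2 - d := by
  have := sq_nonneg t; linarith

theorem param_mem (hd : d < 0) (t : ℝ) : param a d e t ∈ curve6 a d e := by
  have := (sq_sub_pos hd t).ne'
  simp only [zeroSet, P6, param, Set.mem_ofPred_eq, map_sub, map_add, map_mul, map_pow, eval_X,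
    eval_C, Matrix.cons_val_zero, Matrix.cons_val_one]
  field_simp
  ring

theorem eq_param_of_mem (hd : d < 0) {v : Fin 2 → ℝ} (hv : v ∈ curve6 a d e) :
    v = param a d e (v 1) := by
  have h0 : eval v (P6 a d e) = 0 := hv
  simp only [P6, map_sub, map_add, map_mul, map_pow, eval_X, eval_C] at h0
  ext i
  fin_cases i
  · have := (sq_sub_pos hd (v 1)).ne'
    simp only [param, Fin.zero_eta, Matrix.cons_val_zero]
    rw [eq_div_iff this]
    linarith
  · simp [param]

/-- Evaluation of elements of `ℝ[C]` along the parametrization. -/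
def curveEval (a e : ℝ) (hd : d < 0) (t : ℝ) : CoordRing (curve6 a d e) →ₐ[ℝ] ℝ :=
  evalAt (param a d e t) (param_mem hd t)

theorem curveEval_mon (hd : d < 0) (t : ℝ) (i j : ℕ) :
    curveEval a e hd t (mon (curve6 a d e) i j) = ((e - a * t) / (t ^ 2 - d)) ^ i * t ^ j := by
  unfold curveEval mon
  rw [evalAt_restr]
  simp [param]

theorem eq_zero_of_curveEval (hd : d < 0) {f : CoordRing (curve6 a d e)}
    (h : ∀ t, curveEval a e hd t f = 0) : f = 0 := by
  apply eq_zero_of_evalAt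
  intro v hv
  have key : ∀ w (hw : w ∈ curve6 a d e), v = w → evalAt v hv f = evalAt w hw f := by
    rintro _ _ rfl; rfl
  exact (key _ (param_mem hd (v 1)) (eq_param_of_mem hd hv)).trans (h (v 1))

/-! ### Numerators of functions on the curve -/

/-- `f (y² - d)^m`, as a function of the parameter `y`, is the polynomial `q`. -/
def IsNumerator (hd : d < 0) (m : ℕ) (f : CoordRing (curve6 a d e)) (q : Polynomial ℝ) : Prop :=
  ∀ t, curveEval a e hd t f * (t ^ 2 - d) ^ m = q.eval t

section IsNumerator

variable {hd : d < 0} {m n : ℕ} {f g : CoordRing (curve6 a d e)} {p q : Polynomial ℝ}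

theorem IsNumerator.add (hf : IsNumerator hd m f p) (hg : IsNumerator hd m g q) :
    IsNumerator hd m (f + g) (p + q) := fun t => by
  rw [map_add, add_mul, hf t, hg t, Polynomial.eval_add]

theorem IsNumerator.smul (c : ℝ) (hf : IsNumerator hd m f p) :
    IsNumerator hd m (c • f) (c • p) := fun t => by
  rw [map_smul, smul_mul_assoc, hf t, Polynomial.eval_smul]

theorem IsNumerator.zero : IsNumerator hd m (0 : CoordRing (curve6 a d e)) 0 := fun t => by
  simp

theorem IsNumerator.mul (hf : IsNumerator hd m f p) (hg : IsNumerator hd n g q) :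
    IsNumerator hd (m + n) (f * g) (p * q) := fun t => by
  rw [map_mul, Polynomial.eval_mul, ← hf t, ← hg t]; ring

theorem IsNumerator.mul_self (hf : IsNumerator hd m f p) :
    IsNumerator hd (2 * m) (f * f) (p * p) := by
  have := hf.mul hf
  rwa [← two_mul] at this

theorem IsNumerator.congr (hf : IsNumerator hd m f p) (hg : IsNumerator hd m g p) : f = g := by
  rw [← sub_eq_zero]
  refine eq_zero_of_curveEval hd fun t => ?_
  have h : (curveEval a e hd t (f - g)) * (t ^ 2 - d) ^ m = 0 := by
    rw [map_sub, sub_mul, hf t, hg t, sub_self]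
  exact (mul_eq_zero.1 h).resolve_right (pow_ne_zero _ (sq_sub_pos hd t).ne')

theorem IsNumerator.unique (hf : IsNumerator hd m f p) (hg : IsNumerator hd m f q) : p = q :=
  Polynomial.funext fun t => by rw [← hf t, ← hg t]

theorem IsNumerator.raise (hf : IsNumerator hd m f p) :
    IsNumerator hd (m + 1) f ((Polynomial.X ^ 2 - Polynomial.C d) * p) := fun t => by
  rw [Polynomial.eval_mul, ← hf t]; simp; ring

end IsNumerator

/-! ### The complex node at infinity -/

/-- The `y`-coordinate `i√(-d)` of the complex points of the curve at infinity. -/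
def node (d : ℝ) : ℂ := ⟨0, √(-d)⟩

theorem node_sq (hd : d < 0) : node d ^ 2 = d := by
  have := Real.mul_self_sqrt (neg_nonneg.2 hd.le)
  apply Complex.ext <;> simp [node, pow_two]
  linarith

theorem node_im_pos (hd : d < 0) : 0 < √(-d) := Real.sqrt_pos.2 (by linarith)

theorem exists_real_add_mul_node (hd : d < 0) (ζ : ℂ) : ∃ α β : ℝ, ζ = α + β * node d := by
  have := (node_im_pos hd).ne'
  refine ⟨ζ.re, ζ.im / √(-d), ?_⟩
  apply Complex.ext <;> simp [node, this]

theorem exists_eq_mul_of_aeval_node (hd : d < 0) {p : Polynomial ℝ}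
    (hp : Polynomial.aeval (node d) p = 0) :
    ∃ q, p = (Polynomial.X ^ 2 - Polynomial.C d) * q := by
  obtain ⟨q, hq⟩ := Polynomial.quadratic_dvd_of_aeval_eq_zero_im_ne_zero p hp
    (show (node d).im ≠ 0 from (node_im_pos hd).ne')
  refine ⟨q, hq.trans ?_⟩
  congr 1
  have h1 : ‖node d‖ ^ 2 = -d := by
    rw [Complex.sq_norm, Complex.normSq_apply]
    simp [node, Real.mul_self_sqrt (neg_nonneg.2 hd.le)]
  rw [h1]
  simp [node]
  ring

theorem natDegree_of_quadratic_mul_le {q : Polynomial ℝ} {n : ℕ}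
    (h : ((Polynomial.X ^ 2 - Polynomial.C d) * q).natDegree ≤ n + 2) : q.natDegree ≤ n := by
  by_cases hq : q = 0
  · simp [hq]
  rw [(Polynomial.monic_X_pow_sub_C d two_ne_zero).natDegree_mul' hq,
    Polynomial.natDegree_X_pow_sub_C] at h
  omega

/-- The direction `e - a y` of the complex points of the curve at infinity. -/
def nodeDir (a d e : ℝ) : ℂ := e - a * node d

/-- The only use of irreducibility. If the direction vanished, then a = e = 0 and the cubic would be
x(y² - d). Neither factor is a unit: x vanishes at the origin and y² - d at the complex value y =
`node d`. -/
theorem nodeDir_ne_zero (hd : d < 0) (hP : Irreducible (P6 a d e)) : nodeDir a d e ≠ 0 := by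
  intro h
  have him := congrArg Complex.im h
  have hre := congrArg Complex.re h
  have hs := (node_im_pos hd).ne'
  simp [nodeDir, node, hs] at him hre
  subst him hre
  have hfac : P6 0 d 0 = X 0 * (X 1 ^ 2 - C d) := by simp [P6]; ring
  rcases hP.isUnit_or_isUnit hfac with hu | hu
  · have := hu.map (eval (0 : Fin 2 → ℝ))
    simp at this
  · have := hu.map (MvPolynomial.aeval (R := ℝ) (fun _ : Fin 2 => node d))
    simp [node_sq hd] at this

theorem aeval_lin (a d e : ℝ) :
    Polynomial.aeval (node d) (Polynomial.C e - Polynomial.C a * Polynomial.X : Polynomial ℝ)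
      = nodeDir a d e := by
  simp [nodeDir]

theorem aeval_quadratic (hd : d < 0) :
    Polynomial.aeval (node d) (Polynomial.X ^ 2 - Polynomial.C d : Polynomial ℝ) = 0 := by
  simp [node_sq hd]

/-! ### Description of the two spaces by numerators -/

/-- The polynomial functions with numerator of degree at most `n` and value in `ℝ ω` at the
node. -/
def numeratorSpace (a e : ℝ) (hd : d < 0) (m n : ℕ) (ω : ℂ) :
    Submodule ℝ (CoordRing (curve6 a d e)) where
  carrier := {f | ∃ q : Polynomial ℝ, q.natDegree ≤ n ∧
    (∃ r : ℝ, Polynomial.aeval (node d) q = r * ω) ∧ IsNumerator hd m f q}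
  zero_mem' := ⟨0, by simp, ⟨0, by simp⟩, IsNumerator.zero⟩
  add_mem' := by
    rintro f g ⟨p, hp, ⟨r, hr⟩, hf⟩ ⟨q, hq, ⟨s, hs⟩, hg⟩
    refine ⟨p + q, Polynomial.natDegree_add_le_of_degree_le hp hq, ⟨r + s, ?_⟩, hf.add hg⟩
    rw [map_add, hr, hs]; push_cast; ring
  smul_mem' := by
    rintro c f ⟨p, hp, ⟨r, hr⟩, hf⟩
    refine ⟨c • p, (Polynomial.natDegree_smul_le c p).trans hp, ⟨c * r, ?_⟩, hf.smul c⟩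
    rw [map_smul, hr, Complex.real_smul]; push_cast; ring

theorem isNumerator_mon (hd : d < 0) {i m : ℕ} (hi : i ≤ m) (j : ℕ) :
    IsNumerator hd m (mon (curve6 a d e) i j)
      ((Polynomial.C e - Polynomial.C a * Polynomial.X) ^ i * Polynomial.X ^ j *
        (Polynomial.X ^ 2 - Polynomial.C d) ^ (m - i)) := fun t => by
  rw [curveEval_mon]
  have h := (sq_sub_pos hd t).ne'
  obtain ⟨l, rfl⟩ := Nat.exists_eq_add_of_le hi
  simp only [Polynomial.eval_mul, Polynomial.eval_pow, Polynomial.eval_sub, Polynomial.eval_X,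
    Polynomial.eval_C, Nat.add_sub_cancel_left]
  rw [div_pow, pow_add]
  field_simp

theorem natDegree_lin_le (a e : ℝ) :
    (Polynomial.C e - Polynomial.C a * Polynomial.X : Polynomial ℝ).natDegree ≤ 1 := by
  compute_degree

theorem natDegree_mon_le (a d e : ℝ) (i j l : ℕ) :
    ((Polynomial.C e - Polynomial.C a * Polynomial.X) ^ i * Polynomial.X ^ j *
        (Polynomial.X ^ 2 - Polynomial.C d) ^ l : Polynomial ℝ).natDegree ≤ i + j + 2 * l := by
  have h1 := Polynomial.natDegree_pow_le_of_le i (natDegree_lin_le a e)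
  have h2 : ((Polynomial.X : Polynomial ℝ) ^ j).natDegree ≤ j := Polynomial.natDegree_X_pow_le j
  have h3 := Polynomial.natDegree_pow_le_of_le l
    (Polynomial.natDegree_X_pow_sub_C (n := 2) (r := d)).le
  refine (Polynomial.natDegree_mul_le_of_le (Polynomial.natDegree_mul_le_of_le h1 h2) h3).trans ?_
  omega

/-- If i < m, a factor y² - d survives in the numerator and kills the value at the node, whatever ω
is. Only i = m gives a nontrivial condition. -/
theorem mon_mem_numeratorSpace (hd : d < 0) {i j m n : ℕ} {ω : ℂ} (hi : i ≤ m)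
    (hn : i + j + 2 * (m - i) ≤ n) (hω : i < m ∨ ω = nodeDir a d e ^ m * node d ^ j) :
    mon (curve6 a d e) i j ∈ numeratorSpace a e hd m n ω := by
  refine ⟨_, (natDegree_mon_le a d e i j (m - i)).trans hn, ?_, isNumerator_mon hd hi j⟩
  rw [map_mul, map_mul, map_pow, map_pow, map_pow, aeval_lin, aeval_quadratic hd,
    Polynomial.aeval_X]
  by_cases h : i < m
  · exact ⟨0, by rw [zero_pow (by omega)]; simp⟩
  · obtain rfl : i = m := by omega
    refine ⟨1, ?_⟩
    rw [hω.resolve_left h]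
    simp

/-- Of the monomials of degree at most m, only x^m can be nonzero at the node, and its value there
is w^m. -/
theorem coordLE_le_numeratorSpace (hd : d < 0) (m : ℕ) :
    CoordLE (curve6 a d e) m ≤ numeratorSpace a e hd m (3 * m) (nodeDir a d e ^ m) := by
  rintro _ ⟨p, hp, rfl⟩
  have hp' : p.totalDegree ≤ m := (mem_restrictTotalDegree _ _ _).1 hp
  rw [p.as_sum, map_sum]
  refine Submodule.sum_mem _ fun s hs => ?_
  have hmon : restr (curve6 a d e) (monomial s (p.coeff s))
      = p.coeff s • mon (curve6 a d e) (s 0) (s 1) := by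
    unfold mon
    rw [← map_smul]
    congr 1
    rw [monomial_eq, smul_eq_C_mul, Finsupp.prod_fintype _ _ (by simp), Fin.prod_univ_two]
  have hle : s 0 + s 1 ≤ m := by
    have := (le_totalDegree hs).trans hp'
    rwa [Finsupp.sum_fintype _ _ (by simp), Fin.sum_univ_two] at this
  change restr (curve6 a d e) (monomial s (p.coeff s)) ∈ _
  rw [hmon]
  refine Submodule.smul_mem _ _ (mon_mem_numeratorSpace hd (by omega) (by omega) ?_)
  by_cases h : s 0 < m
  · exact Or.inl h
  · right
    rw [show s 1 = 0 by omega, pow_zero, mul_one]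

/-- `ℬ_k` for `ε = 0` and `ℬ̃_k` for `ε = 1`. -/
def basisE (C : Set (Fin 2 → ℝ)) (k ε : ℕ) : Set (CoordRing C) :=
  {mon C k ε} ∪ basisCore C k

theorem span_basisE_le (hd : d < 0) {k ε : ℕ} (hk : 1 ≤ k) (hε : ε ≤ 1) :
    Submodule.span ℝ (basisE (curve6 a d e) k ε)
      ≤ numeratorSpace a e hd k (3 * k) (nodeDir a d e ^ k * node d ^ ε) := by
  rw [Submodule.span_le]
  rintro _ (rfl | ⟨i, hi, hik, rfl | rfl⟩ | ⟨j, hj, rfl⟩)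
  · exact mon_mem_numeratorSpace hd le_rfl (by omega) (Or.inr rfl)
  all_goals exact mon_mem_numeratorSpace hd (by omega) (by omega) (Or.inl (by omega))

/-- Only y^k has a numerator of degree 3k. The coefficient in that degree, the value at t = ∞,
therefore detects the hyperplane. -/
theorem span_basisE_diff_le (hd : d < 0) {k ε : ℕ} (hk : 1 ≤ k) (hε : ε ≤ 1) :
    Submodule.span ℝ (basisE (curve6 a d e) k ε \ {mon (curve6 a d e) 0 k})
      ≤ numeratorSpace a e hd k (3 * k - 1) (nodeDir a d e ^ k * node d ^ ε) := by
  rw [Submodule.span_le]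
  rintro _ ⟨rfl | ⟨i, hi, hik, rfl | rfl⟩ | ⟨j, hj, rfl⟩, hne⟩
  · exact mon_mem_numeratorSpace hd le_rfl (by omega) (Or.inr rfl)
  · exact mon_mem_numeratorSpace hd (by omega) (by omega) (Or.inl (by omega))
  · exact mon_mem_numeratorSpace hd (by omega) (by omega) (Or.inl (by omega))
  · have : j ≠ k := by rintro rfl; exact hne rfl
    exact mon_mem_numeratorSpace hd (by omega) (by omega) (Or.inl (by omega))

/-- The spanning set of the functions with numerator of degree at most `2n + K` over
`(y² - d)^n`. -/
def coreSet (C : Set (Fin 2 → ℝ)) (n K : ℕ) : Set (CoordRing C) :=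
  {b | ∃ i, 1 ≤ i ∧ i ≤ n ∧ (b = mon C i 0 ∨ b = mon C i 1)} ∪ {b | ∃ j ≤ K, b = mon C 0 j}

/-- Since w ≠ 0, the values of x^(n+1) and x^(n+1) y at the node form a real basis of ℂ. Subtracting
a combination makes q vanish at the node, hence divisible by y² - d, and the quotient is handled by
induction. -/
theorem exists_isNumerator_coreSet (hd : d < 0) (hw : nodeDir a d e ≠ 0) (n K : ℕ)
    (q : Polynomial ℝ) (hq : q.natDegree ≤ 2 * n + K) :
    ∃ f ∈ Submodule.span ℝ (coreSet (curve6 a d e) n K), IsNumerator hd n f q := by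
  induction n generalizing q with
  | zero =>
    refine ⟨∑ j ∈ Finset.range (K + 1), q.coeff j • mon (curve6 a d e) 0 j, ?_, fun t => ?_⟩
    · refine Submodule.sum_mem _ fun j hj => Submodule.smul_mem _ _ (Submodule.subset_span ?_)
      exact Or.inr ⟨j, Nat.lt_succ_iff.1 (Finset.mem_range.1 hj), rfl⟩
    · rw [Polynomial.eval_eq_sum_range' (n := K + 1) (by omega), map_sum]
      simp [curveEval_mon]
  | succ n ih =>
    obtain ⟨α, β, hαβ⟩ := exists_real_add_mul_node hd
      (Polynomial.aeval (node d) q / nodeDir a d e ^ (n + 1))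
    rw [div_eq_iff (pow_ne_zero _ hw)] at hαβ
    set l : Polynomial ℝ := Polynomial.C e - Polynomial.C a * Polynomial.X with hl
    have h0 : Polynomial.aeval (node d) (q - (α • l ^ (n + 1) + β • (l ^ (n + 1) * Polynomial.X)))
        = 0 := by
      rw [map_sub, map_add, map_smul, map_smul, map_mul, map_pow, aeval_lin, hαβ,
        Polynomial.aeval_X, Complex.real_smul, Complex.real_smul]
      ring
    obtain ⟨q', hq'⟩ := exists_eq_mul_of_aeval_node hd h0
    have hdl : (l ^ (n + 1)).natDegree ≤ (n + 1) * 1 :=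
      Polynomial.natDegree_pow_le_of_le (n + 1) (natDegree_lin_le a e)
    have hdl' : (l ^ (n + 1) * Polynomial.X).natDegree ≤ (n + 1) * 1 + 1 :=
      Polynomial.natDegree_mul_le_of_le hdl Polynomial.natDegree_X_le
    have hdeg : q'.natDegree ≤ 2 * n + K := by
      apply natDegree_of_quadratic_mul_le (d := d)
      rw [← hq']
      refine (Polynomial.natDegree_sub_le _ _).trans (max_le (by omega) ?_)
      refine Polynomial.natDegree_add_le_of_degree_le ?_ ?_
      · exact (Polynomial.natDegree_smul_le _ _).trans (by omega)
      · exact (Polynomial.natDegree_smul_le _ _).trans (by omega)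
    obtain ⟨f, hf, hfq⟩ := ih q' hdeg
    have h1 : IsNumerator hd (n + 1) (mon (curve6 a d e) (n + 1) 0) (l ^ (n + 1)) := by
      simpa using isNumerator_mon hd (le_refl (n + 1)) 0
    have h2 : IsNumerator hd (n + 1) (mon (curve6 a d e) (n + 1) 1)
        (l ^ (n + 1) * Polynomial.X) := by
      simpa using isNumerator_mon hd (le_refl (n + 1)) 1
    refine ⟨α • mon (curve6 a d e) (n + 1) 0 + β • mon (curve6 a d e) (n + 1) 1 + f, ?_, ?_⟩
    · refine add_mem (add_mem (Submodule.smul_mem _ _ (Submodule.subset_span ?_))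
        (Submodule.smul_mem _ _ (Submodule.subset_span ?_))) (Submodule.span_mono ?_ hf)
      · exact Or.inl ⟨n + 1, by omega, le_rfl, Or.inl rfl⟩
      · exact Or.inl ⟨n + 1, by omega, le_rfl, Or.inr rfl⟩
      · rintro _ (⟨i, hi, hin, h⟩ | h)
        · exact Or.inl ⟨i, hi, by omega, h⟩
        · exact Or.inr h
    · have := ((h1.smul α).add (h2.smul β)).add hfq.raise
      rwa [← hq', add_sub_cancel] at this

/-- Converse to `span_basisE_le`: one multiple of the top monomial x^k y^ε matches the value at the
node, and the rest is divisible by y² - d and falls to `exists_isNumerator_coreSet` with n = k - 1.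
-/
theorem exists_isNumerator_basisE (hd : d < 0) (hw : nodeDir a d e ≠ 0) {k ε : ℕ} (hk : 1 ≤ k)
    (hε : ε ≤ 1) {q : Polynomial ℝ} (hq : q.natDegree ≤ 3 * k) {r : ℝ}
    (hr : Polynomial.aeval (node d) q = r * (nodeDir a d e ^ k * node d ^ ε)) :
    ∃ f ∈ Submodule.span ℝ (basisE (curve6 a d e) k ε), IsNumerator hd k f q := by
  obtain ⟨n, rfl⟩ : ∃ n, k = n + 1 := ⟨k - 1, by omega⟩
  set l : Polynomial ℝ := Polynomial.C e - Polynomial.C a * Polynomial.X with hl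
  have h0 : Polynomial.aeval (node d) (q - r • (l ^ (n + 1) * Polynomial.X ^ ε)) = 0 := by
    rw [map_sub, map_smul, map_mul, map_pow, map_pow, aeval_lin, hr, Polynomial.aeval_X,
      Complex.real_smul, sub_self]
  obtain ⟨q', hq'⟩ := exists_eq_mul_of_aeval_node hd h0
  have hdl : (l ^ (n + 1) * Polynomial.X ^ ε).natDegree ≤ (n + 1) * 1 + ε :=
    Polynomial.natDegree_mul_le_of_le
      (Polynomial.natDegree_pow_le_of_le (n + 1) (natDegree_lin_le a e))
      (Polynomial.natDegree_X_pow_le ε)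
  have hdeg : q'.natDegree ≤ 2 * n + (n + 1) := by
    apply natDegree_of_quadratic_mul_le (d := d)
    rw [← hq']
    refine (Polynomial.natDegree_sub_le _ _).trans (max_le (by omega) ?_)
    exact (Polynomial.natDegree_smul_le _ _).trans (by omega)
  obtain ⟨f, hf, hfq⟩ := exists_isNumerator_coreSet hd hw n (n + 1) q' hdeg
  have h1 : IsNumerator hd (n + 1) (mon (curve6 a d e) (n + 1) ε)
      (l ^ (n + 1) * Polynomial.X ^ ε) := by
    simpa using isNumerator_mon hd (le_refl (n + 1)) ε
  refine ⟨r • mon (curve6 a d e) (n + 1) ε + f, ?_, ?_⟩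
  · exact add_mem (Submodule.smul_mem _ _ (Submodule.subset_span (Or.inl rfl)))
      (Submodule.span_mono (fun _ h => Or.inr h) hf)
  · have := (h1.smul r).add hfq.raise
    rwa [← hq', add_sub_cancel] at this

theorem coordLE_eq_span (hd : d < 0) (hw : nodeDir a d e ≠ 0) {k : ℕ} (hk : 1 ≤ k) :
    CoordLE (curve6 a d e) k = Submodule.span ℝ (basisE (curve6 a d e) k 0) := by
  apply le_antisymm
  · intro f hf
    obtain ⟨q, hq, ⟨r, hr⟩, hfq⟩ := coordLE_le_numeratorSpace hd k hf
    obtain ⟨g, hg, hgq⟩ := exists_isNumerator_basisE hd hw hk zero_le_one hq (r := r)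
      (by rw [hr, pow_zero, mul_one])
    rwa [hfq.congr hgq]
  · rw [Submodule.span_le]
    rintro _ (rfl | ⟨i, hi, hik, rfl | rfl⟩ | ⟨j, hj, rfl⟩) <;> exact mon_mem _ (by omega)

theorem sq_mem_coordLE {k ε : ℕ} (hk : 1 ≤ k) (hε : ε ≤ 1) {g : CoordRing (curve6 a d e)}
    (hg : g ∈ Submodule.span ℝ (basisE (curve6 a d e) k ε)) :
    g * g ∈ CoordLE (curve6 a d e) (2 * k) := by
  obtain rfl | rfl : ε = 0 ∨ ε = 1 := by omega
  · have hle : Submodule.span ℝ (basisE (curve6 a d e) k 0) ≤ CoordLE (curve6 a d e) k := by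
      rw [Submodule.span_le]
      rintro _ (rfl | ⟨i, hi, hik, rfl | rfl⟩ | ⟨j, hj, rfl⟩) <;> exact mon_mem _ (by omega)
    exact coordLE_mul_mem (hle hg) (hle hg)
  · have hg' : toFrac _ g ∈ Vk (curve6 a d e) k := by
      rw [Vk, ← Submodule.map_span]
      exact Submodule.mem_map_of_mem hg
    obtain ⟨f, hf, hfg⟩ := admissible_Vk a d e hk _ hg' _ hg'
    have : f = g * g := toFrac_injective _ (by rw [hfg]; simp)
    rwa [← this]

theorem monic_numerator_pow (d : ℝ) (k : ℕ) :
    (Polynomial.X ^ k * (Polynomial.X ^ 2 - Polynomial.C d) ^ k : Polynomial ℝ).Monic :=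
  (Polynomial.monic_X_pow k).mul ((Polynomial.monic_X_pow_sub_C d two_ne_zero).pow k)

theorem natDegree_numerator_pow (d : ℝ) (k : ℕ) :
    (Polynomial.X ^ k * (Polynomial.X ^ 2 - Polynomial.C d) ^ k : Polynomial ℝ).natDegree
      = 3 * k := by
  rw [Polynomial.Monic.natDegree_mul (Polynomial.monic_X_pow k)
    ((Polynomial.monic_X_pow_sub_C d two_ne_zero).pow k), Polynomial.natDegree_X_pow,
    Polynomial.natDegree_pow, Polynomial.natDegree_X_pow_sub_C]
  ring

/-- The coordinate along y^k is well determined, as the coefficient of the numerator in degree 3k.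
-/
theorem exists_eq_smul_add_of_mem_span_basisE (hd : d < 0) {k ε : ℕ} (hk : 1 ≤ k) (hε : ε ≤ 1)
    {g : CoordRing (curve6 a d e)} (hg : g ∈ Submodule.span ℝ (basisE (curve6 a d e) k ε)) :
    ∃ r : ℝ, ∃ u ∈ Submodule.span ℝ (basisE (curve6 a d e) k ε \ {mon (curve6 a d e) 0 k}),
      g = r • mon (curve6 a d e) 0 k + u ∧
      ∀ q, IsNumerator hd k g q → q.coeff (3 * k) = r := by
  have hins : basisE (curve6 a d e) k ε
      = insert (mon (curve6 a d e) 0 k)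
        (basisE (curve6 a d e) k ε \ {mon (curve6 a d e) 0 k}) := by
    rw [Set.insert_sdiff_singleton, Set.insert_eq_of_mem]
    exact Or.inr (Or.inr ⟨k, le_rfl, rfl⟩)
  rw [hins, Submodule.mem_span_insert] at hg
  obtain ⟨r, u, hu, rfl⟩ := hg
  refine ⟨r, u, hu, rfl, fun q hq => ?_⟩
  obtain ⟨p, hp, -, hup⟩ := span_basisE_diff_le hd hk hε hu
  have h1 := isNumerator_mon (a := a) (e := e) hd (Nat.zero_le k) k
  rw [hq.unique ((h1.smul r).add hup), Polynomial.coeff_add,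
    Polynomial.coeff_eq_zero_of_natDegree_lt (p := p) (by omega), Polynomial.coeff_smul]
  have := (monic_numerator_pow d k).coeff_natDegree
  rw [natDegree_numerator_pow] at this
  simp [this]

end CubicTMP

/-! ### Homogenization on the circle -/

namespace CubicTMP

/-- The value at a point `s + ir` of the unit circle of the homogenization in degree `n`. -/
def homogEval (n : ℕ) : Polynomial ℝ →ₗ[ℝ] C(Metric.sphere (0 : ℂ) 1, ℝ) where
  toFun q := ⟨fun x => ∑ j ∈ Finset.range (n + 1),
    q.coeff j * ((x : ℂ).re ^ j * (x : ℂ).im ^ (n - j)), by fun_prop⟩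
  map_add' p q := by
    ext x
    simp [add_mul, Finset.sum_add_distrib]
  map_smul' c q := by
    ext x
    simp [Finset.mul_sum, mul_assoc]

theorem homogEval_apply (n : ℕ) (q : Polynomial ℝ) (x : Metric.sphere (0 : ℂ) 1) :
    homogEval n q x = ∑ j ∈ Finset.range (n + 1),
      q.coeff j * ((x : ℂ).re ^ j * (x : ℂ).im ^ (n - j)) := rfl

theorem homogEval_of_im_ne_zero {n : ℕ} {q : Polynomial ℝ} (hq : q.natDegree ≤ n)
    {x : Metric.sphere (0 : ℂ) 1} (hx : (x : ℂ).im ≠ 0) :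
    homogEval n q x = (x : ℂ).im ^ n * q.eval ((x : ℂ).re / (x : ℂ).im) := by
  rw [homogEval_apply, Polynomial.eval_eq_sum_range' (n := n + 1) (by omega), Finset.mul_sum]
  refine Finset.sum_congr rfl fun j hj => ?_
  obtain ⟨l, rfl⟩ := Nat.exists_eq_add_of_le (Nat.lt_succ_iff.1 (Finset.mem_range.1 hj))
  rw [Nat.add_sub_cancel_left, div_pow, pow_add]
  field_simp

/-- The points ±1 stand for t = ∞, where only the coefficient of degree n survives. -/
theorem homogEval_of_im_eq_zero (n : ℕ) (q : Polynomial ℝ)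
    {x : Metric.sphere (0 : ℂ) 1} (hx : (x : ℂ).im = 0) :
    homogEval n q x = q.coeff n * (x : ℂ).re ^ n := by
  rw [homogEval_apply, Finset.sum_range_succ, Finset.sum_eq_zero, zero_add, Nat.sub_self, pow_zero, mul_one]
  intro j hj
  have := Finset.mem_range.1 hj
  rw [hx, zero_pow (by omega)]
  simp

theorem re_ne_zero_of_im_eq_zero {x : Metric.sphere (0 : ℂ) 1} (hx : (x : ℂ).im = 0) :
    (x : ℂ).re ≠ 0 := by
  intro h
  have : (x : ℂ) = 0 := Complex.ext h hx
  have h1 := x.2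
  rw [this] at h1
  simp at h1

theorem homogEval_mul_self {n : ℕ} {q : Polynomial ℝ} (hq : q.natDegree ≤ n)
    (x : Metric.sphere (0 : ℂ) 1) : homogEval (2 * n) (q * q) x = homogEval n q x ^ 2 := by
  have hqq : (q * q).natDegree ≤ 2 * n :=
    (Polynomial.natDegree_mul_le_of_le hq hq).trans (by omega)
  by_cases hx : (x : ℂ).im = 0
  · rw [homogEval_of_im_eq_zero _ _ hx, homogEval_of_im_eq_zero _ _ hx, two_mul,
      Polynomial.coeff_mul_add_eq_of_natDegree_le hq hq]
    ring
  · rw [homogEval_of_im_ne_zero hqq hx, homogEval_of_im_ne_zero hq hx, Polynomial.eval_mul]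
    ring

/-- The point of the unit circle in direction `t + i`. -/
def circlePoint (t : ℝ) : Metric.sphere (0 : ℂ) 1 :=
  ⟨(‖(⟨t, 1⟩ : ℂ)‖⁻¹ : ℝ) * ⟨t, 1⟩, by
    have h : ‖(⟨t, 1⟩ : ℂ)‖ ≠ 0 := by
      rw [norm_ne_zero_iff]
      intro h
      simpa using congrArg Complex.im h
    simp [h]⟩

theorem nonneg_of_homogEval_nonneg {n : ℕ} {q : Polynomial ℝ} (hq : q.natDegree ≤ 2 * n)
    (h : ∀ x, 0 ≤ homogEval (2 * n) q x) (t : ℝ) : 0 ≤ q.eval t := by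
  have hn : ‖(⟨t, 1⟩ : ℂ)‖ ≠ 0 := by
    rw [norm_ne_zero_iff]
    intro h
    simpa using congrArg Complex.im h
  have him : (circlePoint t : ℂ).im = ‖(⟨t, 1⟩ : ℂ)‖⁻¹ := by simp [circlePoint]
  have hre : (circlePoint t : ℂ).re = ‖(⟨t, 1⟩ : ℂ)‖⁻¹ * t := by simp [circlePoint]
  have hne : (circlePoint t : ℂ).im ≠ 0 := by rw [him]; exact inv_ne_zero hn
  have h1 := h (circlePoint t)
  rw [homogEval_of_im_ne_zero hq hne, pow_mul,
    show (circlePoint t : ℂ).re / (circlePoint t : ℂ).im = t by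
      rw [hre, him]; field_simp] at h1
  exact nonneg_of_mul_nonneg_right h1 (by positivity)

theorem homogEval_quadratic_pow_pos {d : ℝ} (hd : d < 0) (n : ℕ) (x : Metric.sphere (0 : ℂ) 1) :
    0 < homogEval (2 * n) ((Polynomial.X ^ 2 - Polynomial.C d) ^ n) x := by
  have hdeg : ((Polynomial.X ^ 2 - Polynomial.C d) ^ n : Polynomial ℝ).natDegree = 2 * n := by
    rw [Polynomial.natDegree_pow, Polynomial.natDegree_X_pow_sub_C, mul_comm]
  by_cases hx : (x : ℂ).im = 0
  · have hm := ((Polynomial.monic_X_pow_sub_C d two_ne_zero).pow n).coeff_natDegree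
    rw [hdeg] at hm
    have := re_ne_zero_of_im_eq_zero hx
    rw [homogEval_of_im_eq_zero _ _ hx, hm, one_mul, pow_mul]
    positivity
  · rw [homogEval_of_im_ne_zero hdeg.le hx, pow_mul]
    have := sq_sub_pos hd ((x : ℂ).re / (x : ℂ).im)
    simp only [Polynomial.eval_pow, Polynomial.eval_sub, Polynomial.eval_X, Polynomial.eval_C]
    positivity

/-! ### Sums of squares on the curve and the representing measure -/

variable {a d e : ℝ}

/-- A function of degree at most `2k` on the curve whose numerator is nonnegative is the sum of
the square of an element of `Lin ℬ_k` and the square of an element of `Lin ℬ̃_k`. -/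
theorem exists_eq_sq_add_sq (hd : d < 0) (hw : nodeDir a d e ≠ 0) {k : ℕ} (hk : 1 ≤ k)
    {f : CoordRing (curve6 a d e)} (hf : f ∈ CoordLE (curve6 a d e) (2 * k)) {q : Polynomial ℝ}
    (hfq : IsNumerator hd (2 * k) f q) (hq : ∀ t, 0 ≤ q.eval t) :
    ∃ g ∈ Submodule.span ℝ (basisE (curve6 a d e) k 0),
      ∃ h ∈ Submodule.span ℝ (basisE (curve6 a d e) k 1), f = g * g + h * h := by
  obtain ⟨q', hdeg, ⟨r, hr⟩, hfq'⟩ := coordLE_le_numeratorSpace hd (2 * k) hf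
  obtain rfl := hfq.unique hfq'
  obtain ⟨f₀, g₀, rfl⟩ := Polynomial.exists_eq_sq_add_sq_of_nonneg q hq
  obtain ⟨hf₀, hg₀⟩ := Polynomial.natDegree_le_of_natDegree_sq_add_sq_le
    (n := 3 * k) (hdeg.trans (by omega))
  have hwk := pow_ne_zero k hw
  obtain ⟨α, hα⟩ : ∃ α, Polynomial.aeval (node d) f₀ = α * nodeDir a d e ^ k :=
    ⟨_, (div_mul_cancel₀ _ hwk).symm⟩
  obtain ⟨β, hβ⟩ : ∃ β, Polynomial.aeval (node d) g₀ = β * nodeDir a d e ^ k :=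
    ⟨_, (div_mul_cancel₀ _ hwk).symm⟩
  -- Membership in degree at most 2k enters here: it makes the value at the node a real multiple of
  -- w^(2k).
  have hsum : α ^ 2 + β ^ 2 = r := by
    rw [map_add, map_pow, map_pow, hα, hβ] at hr
    apply mul_right_cancel₀ (pow_ne_zero 2 hwk)
    rw [← pow_mul, mul_comm k 2, ← hr]
    ring
  -- The rotated pair has the same sum of squares. A real value at the node, relative to w^k, means
  -- Lin ℬ_k; a purely imaginary one is a real multiple of `node d` and means Lin ℬ̃_k.
  obtain ⟨c, s, hcs, hre, him⟩ := Complex.exists_rotation_of_im_sq_add_sq_eq_zero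
    (α := α) (β := β) (by rw [hsum]; simp)
  obtain ⟨ρ, hρ⟩ : ∃ ρ : ℝ, c * α + s * β = ρ := ⟨_, Complex.ext rfl (by simpa using hre)⟩
  obtain ⟨σ, hσ⟩ : ∃ σ : ℝ, c * β - s * α = σ * node d := by
    refine ⟨(c * β - s * α).im / √(-d), Complex.ext ?_ ?_⟩
    · rw [him]; simp [node]
    · have := (node_im_pos hd).ne'
      simp only [node, Complex.mul_im, Complex.ofReal_re, Complex.ofReal_im, mul_zero, add_zero]
      field_simp
  have hdeg' : ∀ x y : ℝ, (x • f₀ + y • g₀).natDegree ≤ 3 * k := fun x y =>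
    Polynomial.natDegree_add_le_of_degree_le ((Polynomial.natDegree_smul_le _ _).trans hf₀)
      ((Polynomial.natDegree_smul_le _ _).trans hg₀)
  obtain ⟨g, hg, hgq⟩ := exists_isNumerator_basisE (ε := 0) hd hw hk zero_le_one (hdeg' c s)
    (r := ρ) (by
      rw [map_add, map_smul, map_smul, hα, hβ, Complex.real_smul, Complex.real_smul, ← hρ]
      ring)
  obtain ⟨h, hh, hhq⟩ := exists_isNumerator_basisE (ε := 1) hd hw hk le_rfl (hdeg' (-s) c)
    (r := σ) (by
      rw [map_add, map_smul, map_smul, hα, hβ, Complex.real_smul, Complex.real_smul, pow_one,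
        Complex.ofReal_neg]
      linear_combination nodeDir a d e ^ k * hσ)
  refine ⟨g, hg, h, hh, IsNumerator.congr hfq fun t => ?_⟩
  rw [map_add, add_mul, hgq.mul_self t, hhq.mul_self t]
  simp only [Polynomial.eval_mul, Polynomial.eval_add, Polynomial.eval_smul, Polynomial.eval_pow,
    smul_eq_mul]
  linear_combination (Polynomial.eval t f₀ ^ 2 + Polynomial.eval t g₀ ^ 2) * hcs

theorem measurableSet_curve6 (a d e : ℝ) : MeasurableSet (curve6 a d e) :=
  (isClosed_eq (MvPolynomial.continuous_eval (P6 a d e)) continuous_const).measurableSet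

/-- The pairs of a function of degree at most `2k` and its numerator. -/
def numeratorGraph (a e : ℝ) (hd : d < 0) (k : ℕ) :
    Submodule ℝ (CoordLE (curve6 a d e) (2 * k) × Polynomial ℝ) where
  carrier := {x | IsNumerator hd (2 * k) (x.1 : CoordRing (curve6 a d e)) x.2}
  zero_mem' := IsNumerator.zero
  add_mem' h h' := IsNumerator.add h h'
  smul_mem' c _ h := IsNumerator.smul c h

theorem exists_measure_circle (hd : d < 0) (hw : nodeDir a d e ≠ 0) {k : ℕ} (hk : 1 ≤ k)
    (Λ : CoordLE (curve6 a d e) (2 * k) →ₗ[ℝ] ℝ)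
    (hΛ : ∀ ε ≤ 1, ∀ g ∈ Submodule.span ℝ (basisE (curve6 a d e) k ε),
      ∀ f : CoordLE (curve6 a d e) (2 * k), (f : CoordRing (curve6 a d e)) = g * g → 0 ≤ Λ f) :
    ∃ ν : Measure (Metric.sphere (0 : ℂ) 1), IsFiniteMeasure ν ∧
      ∀ (f : CoordLE (curve6 a d e) (2 * k)) (q : Polynomial ℝ),
        IsNumerator hd (2 * k) (f : CoordRing (curve6 a d e)) q →
          Λ f = ∫ x, homogEval (2 * (3 * k)) q x ∂ν := by
  have hdeg : ∀ (f : CoordLE (curve6 a d e) (2 * k)) (q : Polynomial ℝ),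
      IsNumerator hd (2 * k) (f : CoordRing (curve6 a d e)) q → q.natDegree ≤ 2 * (3 * k) := by
    intro f q hfq
    obtain ⟨q', hq', -, hfq'⟩ := coordLE_le_numeratorSpace hd (2 * k) f.2
    rw [hfq.unique hfq']
    omega
  obtain ⟨ν, hν, h⟩ := exists_measure_of_nonneg_on_nonneg
    -- On pairs of a function and its numerator both maps come from linear projections, so no
    -- numerator has to be chosen.
    (M := numeratorGraph a e hd k)
    ((homogEval (2 * (3 * k))).comp ((LinearMap.snd ℝ _ _).comp (Submodule.subtype _)))
    (Λ.comp ((LinearMap.fst ℝ _ _).comp (Submodule.subtype _)))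
    (by
      rintro ⟨⟨f, q⟩, hfq⟩ hpos
      obtain ⟨g, hg, h, hh, hgh⟩ := exists_eq_sq_add_sq hd hw hk f.2 hfq
        (nonneg_of_homogEval_nonneg (hdeg f q hfq) hpos)
      have hfeq : f = ⟨g * g, sq_mem_coordLE hk zero_le_one hg⟩
          + ⟨h * h, sq_mem_coordLE hk le_rfl hh⟩ := Subtype.ext hgh
      change 0 ≤ Λ f
      rw [hfeq, map_add]
      exact add_nonneg (hΛ 0 zero_le_one g hg _ rfl) (hΛ 1 le_rfl h hh _ rfl))
    (by
      -- The strictly positive element is (y² - d)^k: over the denominator (y² - d)^(2k) its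
      -- numerator is (t² - d)^(3k), positive also at infinity.
      have hmem : restr (curve6 a d e) ((X 1 ^ 2 - C d) ^ k)
          ∈ CoordLE (curve6 a d e) (2 * k) := by
        apply restr_mem
        rw [mem_restrictTotalDegree]
        refine (totalDegree_pow _ _).trans ?_
        rw [mul_comm 2 k]
        refine Nat.mul_le_mul_left k ((totalDegree_sub _ _).trans (max_le ?_ ?_))
        · exact (totalDegree_pow _ _).trans (by simp)
        · simp
      have hnum : IsNumerator hd (2 * k) (restr (curve6 a d e) ((X 1 ^ 2 - C d) ^ k))
          ((Polynomial.X ^ 2 - Polynomial.C d) ^ (3 * k)) := fun t => by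
        unfold curveEval
        rw [evalAt_restr]
        simp [param]
        ring
      exact ⟨⟨⟨⟨_, hmem⟩, _⟩, hnum⟩, homogEval_quadratic_pow_pos hd (3 * k)⟩)
  exact ⟨ν, hν, fun f q hfq => h ⟨⟨f, q⟩, hfq⟩⟩

/-- The circle measure integrates the square of the homogenized numerator of g to zero, and this is
nonzero at infinity because g involves y^k. So infinity carries no mass, and the measure, weighted
by the cleared denominator, pushes forward to the curve. -/
theorem isMomentFunctional_of_sq_eq_zero (hd : d < 0) (hw : nodeDir a d e ≠ 0) {k : ℕ}
    (hk : 1 ≤ k) (L : PolyLE (2 * k) →ₗ[ℝ] ℝ) (hL : Descends (curve6 a d e) L)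
    (hpos : ∀ ε ≤ 1, ∀ g ∈ Submodule.span ℝ (basisE (curve6 a d e) k ε),
      ∀ f : CoordLE (curve6 a d e) (2 * k), (f : CoordRing (curve6 a d e)) = g * g →
        0 ≤ induced L hL f)
    {ε : ℕ} (hε : ε ≤ 1) {g : CoordRing (curve6 a d e)}
    (hg : g ∈ Submodule.span ℝ (basisE (curve6 a d e) k ε))
    (hgU : g ∉ Submodule.span ℝ (basisE (curve6 a d e) k ε \ {mon (curve6 a d e) 0 k}))
    (h0 : induced L hL ⟨g * g, sq_mem_coordLE hk hε hg⟩ = 0) :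
    IsMomentFunctional (curve6 a d e) L := by
  obtain ⟨ν, hν, hint⟩ := exists_measure_circle hd hw hk (induced L hL) hpos
  obtain ⟨q, hq, -, hgq⟩ := span_basisE_le hd hk hε hg
  have hlead : q.coeff (3 * k) ≠ 0 := by
    obtain ⟨r, u, hu, rfl, hr⟩ := exists_eq_smul_add_of_mem_span_basisE hd hk hε hg
    rw [hr q hgq]
    rintro rfl
    exact hgU (by simpa using hu)
  have hfin : ∀ φ : C(Metric.sphere (0 : ℂ) 1, ℝ), Integrable (fun x => φ x) ν := fun φ =>
    φ.continuous.integrable_of_hasCompactSupport (HasCompactSupport.of_compactSpace _)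
  have hae : ∀ᵐ x ∂ν, ((x : Metric.sphere (0 : ℂ) 1) : ℂ).im ≠ 0 := by
    have h1 := hint ⟨g * g, sq_mem_coordLE hk hε hg⟩ (q * q)
      hgq.mul_self
    rw [h0] at h1
    have h2 := (integral_eq_zero_iff_of_nonneg (μ := ν)
      (f := fun x => homogEval (2 * (3 * k)) (q * q) x)
      (fun x => by simp only [Pi.zero_apply]; rw [homogEval_mul_self hq]; positivity)
      (hfin _)).1 h1.symm
    filter_upwards [h2] with x hx him
    simp only [Pi.zero_apply] at hx
    rw [homogEval_mul_self hq, homogEval_of_im_eq_zero _ _ him] at hx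
    exact pow_ne_zero 2 (mul_ne_zero hlead (pow_ne_zero _ (re_ne_zero_of_im_eq_zero him))) hx
  let Φ : Metric.sphere (0 : ℂ) 1 → (Fin 2 → ℝ) :=
    fun x => param a d e ((x : ℂ).re / (x : ℂ).im)
  have hΦ : Measurable Φ := by
    have ht : Measurable fun x : Metric.sphere (0 : ℂ) 1 => (x : ℂ).re / (x : ℂ).im :=
      (Complex.measurable_re.comp measurable_subtype_coe).div
        (Complex.measurable_im.comp measurable_subtype_coe)
    refine measurable_pi_iff.2 fun i => ?_
    fin_cases i
    · exact (measurable_const.sub (ht.const_mul a)).div ((ht.pow_const 2).sub_const d)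
    · exact ht
  -- Homogenizing f (t² - d)^(2k) in degree 6k at t = re/im gives f times im^(6k) (t² - d)^(2k),
  -- which is this weight.
  let ω : Metric.sphere (0 : ℂ) 1 → NNReal := fun x =>
    ⟨((x : ℂ).im ^ 2) ^ k * ((x : ℂ).re ^ 2 - d * (x : ℂ).im ^ 2) ^ (2 * k), by
      rw [pow_mul _ 2 k]
      positivity⟩
  have hω : Measurable ω := by
    apply Continuous.measurable
    exact Continuous.subtype_mk (by fun_prop) _
  -- Even where im = 0 the image is on the curve, since division by zero gives the parameter t = 0.
  have hnull : ((ν.withDensity fun x => (ω x : ENNReal)).map Φ) (curve6 a d e)ᶜ = 0 := by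
    rw [Measure.map_apply hΦ (measurableSet_curve6 a d e).compl]
    convert measure_empty (μ := ν.withDensity fun x => (ω x : ENNReal))
    ext x
    simp [Φ, param_mem hd]
  refine ⟨_, hnull, fun p => ?_⟩
  obtain ⟨qp, hqp, -, hpq⟩ := coordLE_le_numeratorSpace hd (2 * k)
    (restr_mem (C := curve6 a d e) p.2)
  have hp : (fun x => ω x • eval (Φ x) (p : MvPolynomial (Fin 2) ℝ))
      =ᵐ[ν] fun x => homogEval (2 * (3 * k)) qp x := by
    filter_upwards [hae] with x hx
    rw [homogEval_of_im_ne_zero (by omega) hx, ← hpq]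
    unfold curveEval
    rw [evalAt_restr]
    change (((x : ℂ).im ^ 2) ^ k * ((x : ℂ).re ^ 2 - d * (x : ℂ).im ^ 2) ^ (2 * k)) *
      eval (Φ x) (p : MvPolynomial (Fin 2) ℝ) = _
    have h1 : (x : ℂ).re ^ 2 - d * (x : ℂ).im ^ 2
        = (x : ℂ).im ^ 2 * (((x : ℂ).re / (x : ℂ).im) ^ 2 - d) := by field_simp
    rw [h1, mul_pow]
    ring
  have hmeas : Measurable fun v : Fin 2 → ℝ => eval v (p : MvPolynomial (Fin 2) ℝ) :=
    (MvPolynomial.continuous_eval _).measurable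
  constructor
  · rw [integrable_map_measure hmeas.aestronglyMeasurable hΦ.aemeasurable,
      integrable_withDensity_iff_integrable_smul hω]
    exact (hfin (homogEval (2 * (3 * k)) qp)).congr hp.symm
  · have hres : ((ν.withDensity fun x => (ω x : ENNReal)).map Φ).restrict (curve6 a d e)
        = (ν.withDensity fun x => (ω x : ENNReal)).map Φ :=
      Measure.restrict_eq_self_of_ae_mem (by rwa [ae_iff])
    rw [hres, integral_map hΦ.aemeasurable hmeas.aestronglyMeasurable,
      integral_withDensity_eq_integral_smul hω, integral_congr_ae hp,
      ← hint ⟨_, restr_mem p.2⟩ qp hpq, induced_apply]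

end CubicTMP

/-! ### Singularity, annihilated squares and the rank conditions -/

namespace CubicTMP

variable {a d e : ℝ}

theorem notMem_span_basisE_diff (hd : d < 0) {k ε : ℕ} (hk : 1 ≤ k) (hε : ε ≤ 1)
    {g : CoordRing (curve6 a d e)} {q : Polynomial ℝ} (hg : IsNumerator hd k g q)
    (hq : q.natDegree = 3 * k) :
    g ∉ Submodule.span ℝ (basisE (curve6 a d e) k ε \ {mon (curve6 a d e) 0 k}) := by
  intro h
  obtain ⟨p, hp, -, hgp⟩ := span_basisE_diff_le hd hk hε h
  rw [hg.unique hgp] at hq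
  omega

theorem mon_zero_notMem_span_basisE_diff (hd : d < 0) {k ε : ℕ} (hk : 1 ≤ k) (hε : ε ≤ 1) :
    mon (curve6 a d e) 0 k ∉
      Submodule.span ℝ (basisE (curve6 a d e) k ε \ {mon (curve6 a d e) 0 k}) := by
  refine notMem_span_basisE_diff hd hk hε (isNumerator_mon hd (Nat.zero_le k) k) ?_
  rw [pow_zero, one_mul, Nat.sub_zero, natDegree_numerator_pow]

theorem exists_sub_smul_mem (hd : d < 0) {k ε : ℕ} (hk : 1 ≤ k) (hε : ε ≤ 1)
    {f g : CoordRing (curve6 a d e)} (hf : f ∈ Submodule.span ℝ (basisE (curve6 a d e) k ε))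
    (hg : g ∈ Submodule.span ℝ (basisE (curve6 a d e) k ε))
    (hgU : g ∉ Submodule.span ℝ (basisE (curve6 a d e) k ε \ {mon (curve6 a d e) 0 k})) :
    ∃ r : ℝ, f - r • g ∈
      Submodule.span ℝ (basisE (curve6 a d e) k ε \ {mon (curve6 a d e) 0 k}) := by
  obtain ⟨s, u, hu, rfl, -⟩ := exists_eq_smul_add_of_mem_span_basisE hd hk hε hf
  obtain ⟨t, v, hv, rfl, -⟩ := exists_eq_smul_add_of_mem_span_basisE hd hk hε hg
  have ht : t ≠ 0 := by
    rintro rfl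
    exact hgU (by simpa using hv)
  refine ⟨s / t, ?_⟩
  rw [smul_add, smul_smul, div_mul_cancel₀ _ ht, add_sub_add_left_eq_sub]
  exact sub_mem hu (Submodule.smul_mem _ _ hv)

theorem eval_lift {k : ℕ} {C : Set (Fin 2 → ℝ)} (f : CoordLE C k) {v : Fin 2 → ℝ} (hv : v ∈ C) :
    eval v (lift f : MvPolynomial (Fin 2) ℝ) = evalAt v hv (f : CoordRing C) := by
  rw [← restr_lift f, evalAt_restr]

theorem IsMomentFunctional.induced_sq_nonneg {k : ℕ} {L : PolyLE (2 * k) →ₗ[ℝ] ℝ}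
    (hL : Descends (curve6 a d e) L) (hM : IsMomentFunctional (curve6 a d e) L)
    {g : CoordRing (curve6 a d e)} (f : CoordLE (curve6 a d e) (2 * k))
    (hf : (f : CoordRing (curve6 a d e)) = g * g) : 0 ≤ induced L hL f := by
  obtain ⟨μ, -, hμ⟩ := hM
  change 0 ≤ L (lift f)
  rw [(hμ _).2]
  refine setIntegral_nonneg (measurableSet_curve6 a d e) fun v hv => ?_
  rw [eval_lift f hv, hf, map_mul]
  exact mul_self_nonneg _

/-- A vanishing integral of g² puts the measure on the zeros of g, where g' vanishes too. -/
theorem IsMomentFunctional.induced_sq_eq_zero {k : ℕ} {L : PolyLE (2 * k) →ₗ[ℝ] ℝ}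
    (hL : Descends (curve6 a d e) L) (hM : IsMomentFunctional (curve6 a d e) L)
    {g g' : CoordRing (curve6 a d e)} (f f' : CoordLE (curve6 a d e) (2 * k))
    (hf : (f : CoordRing (curve6 a d e)) = g * g) (hf' : (f' : CoordRing (curve6 a d e)) = g' * g')
    (h : ∀ v (hv : v ∈ curve6 a d e), evalAt v hv g = 0 → evalAt v hv g' = 0)
    (h0 : induced L hL f = 0) : induced L hL f' = 0 := by
  obtain ⟨μ, -, hμ⟩ := hM
  have hC := measurableSet_curve6 a d e
  change L (lift f) = 0 at h0
  change L (lift f') = 0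
  rw [(hμ _).2] at h0 ⊢
  rw [setIntegral_eq_zero_iff_of_nonneg_ae _ (hμ _).1.integrableOn] at h0
  · refine integral_eq_zero_of_ae ?_
    filter_upwards [h0, ae_restrict_mem hC] with v hv hvC
    simp only [Pi.zero_apply] at hv ⊢
    rw [eval_lift f hvC, hf, map_mul, mul_self_eq_zero] at hv
    rw [eval_lift f' hvC, hf', map_mul, h v hvC hv, mul_zero]
  · filter_upwards [ae_restrict_mem hC] with v hvC
    simp only [Pi.zero_apply]
    rw [eval_lift f hvC, hf, map_mul]
    exact mul_self_nonneg _

/-- Multiplying a numerator by a polynomial moves a function into one of the two spaces, outside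
of the hyperplane without `y^k`. -/
theorem exists_notMem_of_ne_zero (hd : d < 0) (hw : nodeDir a d e ≠ 0) {k ε : ℕ} (hk : 1 ≤ k)
    (hε : ε ≤ 1) {g : CoordRing (curve6 a d e)}
    (hg : g ∈ Submodule.span ℝ (basisE (curve6 a d e) k ε)) (hg0 : g ≠ 0) :
    ∃ δ ≤ 1, ∃ g' ∈ Submodule.span ℝ (basisE (curve6 a d e) k δ),
      g' ∉ Submodule.span ℝ (basisE (curve6 a d e) k δ \ {mon (curve6 a d e) 0 k}) ∧
      ∀ v (hv : v ∈ curve6 a d e), evalAt v hv g = 0 → evalAt v hv g' = 0 := by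
  obtain ⟨q, hq, ⟨r, hr⟩, hgq⟩ := span_basisE_le hd hk hε hg
  have hq0 : q ≠ 0 := by
    rintro rfl
    exact hg0 (hgq.congr IsNumerator.zero)
  -- The factor X^i (X² - d)^j fills the degree up to 3k; i is the parity of the gap. The factor X²
  -- - d adds no real zero, and extra zeros from X do no harm.
  obtain ⟨i, j, hi, hij⟩ : ∃ i j, i ≤ 1 ∧ q.natDegree + (i + 2 * j) = 3 * k :=
    ⟨(3 * k - q.natDegree) % 2, (3 * k - q.natDegree) / 2, by omega, by omega⟩
  have hX := Polynomial.monic_X_pow (R := ℝ) i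
  have hQ := (Polynomial.monic_X_pow_sub_C d two_ne_zero).pow j
  have hdeg : (q * (Polynomial.X ^ i * (Polynomial.X ^ 2 - Polynomial.C d) ^ j)).natDegree
      = 3 * k := by
    rw [Polynomial.natDegree_mul hq0 (hX.mul hQ).ne_zero, hX.natDegree_mul hQ,
      Polynomial.natDegree_X_pow, Polynomial.natDegree_pow, Polynomial.natDegree_X_pow_sub_C]
    omega
  obtain ⟨δ, hδ, s, hs⟩ : ∃ δ ≤ 1, ∃ s : ℝ, Polynomial.aeval (node d)
      (q * (Polynomial.X ^ i * (Polynomial.X ^ 2 - Polynomial.C d) ^ j))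
        = s * (nodeDir a d e ^ k * node d ^ δ) := by
    rw [map_mul, map_mul, map_pow, map_pow, aeval_quadratic hd, hr, Polynomial.aeval_X]
    -- For j > 0 the value at the node is 0 and either space would do. For j = 0 the factor X^i
    -- shifts ε by i, and node² = d being real folds 2 back to 0.
    rcases Nat.eq_zero_or_pos j with rfl | hj
    · obtain hle | ⟨rfl, rfl⟩ : ε + i ≤ 1 ∨ ε = 1 ∧ i = 1 := by omega
      · exact ⟨ε + i, hle, r, by ring⟩
      · refine ⟨0, zero_le_one, r * d, ?_⟩
        push_cast
        rw [← node_sq hd]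
        ring
    · exact ⟨0, zero_le_one, 0, by rw [zero_pow hj.ne']; simp⟩
  obtain ⟨g', hg', hgq'⟩ := exists_isNumerator_basisE hd hw hk hδ hdeg.le hs
  refine ⟨δ, hδ, g', hg', notMem_span_basisE_diff hd hk hδ hgq' hdeg, fun v hv h0 => ?_⟩
  obtain ⟨t, rfl⟩ : ∃ t, v = param a d e t := ⟨_, eq_param_of_mem hd hv⟩
  have h1 : q.eval t = 0 := by
    rw [← hgq t]
    exact mul_eq_zero_of_left h0 _
  have h2 := hgq' t
  rw [Polynomial.eval_mul, h1, zero_mul] at h2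
  exact (mul_eq_zero.1 h2).resolve_right (pow_ne_zero _ (sq_sub_pos hd t).ne')

theorem toFrac_mem_Vk {C : Set (Fin 2 → ℝ)} {k : ℕ} {g : CoordRing C} :
    toFrac C g ∈ Vk C k ↔ g ∈ Submodule.span ℝ (basisE C k 1) := by
  rw [Vk, ← Submodule.map_span, Submodule.mem_map]
  exact ⟨fun ⟨_, h, hg⟩ => toFrac_injective C hg ▸ h, fun h => ⟨g, h, rfl⟩⟩

theorem toFrac_mem_Wk {C : Set (Fin 2 → ℝ)} {k : ℕ} {g : CoordRing C} :
    toFrac C g ∈ Wk C k ↔ g ∈ Submodule.span ℝ (basisE C k 1 \ {mon C 0 k}) := by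
  rw [Wk, ← Submodule.map_span, Submodule.mem_map]
  exact ⟨fun ⟨_, h, hg⟩ => toFrac_injective C hg ▸ h, fun h => ⟨g, h, rfl⟩⟩

theorem exists_toFrac_eq {C : Set (Fin 2 → ℝ)} {k : ℕ} (g : Vk C k) :
    ∃ g₀ ∈ Submodule.span ℝ (basisE C k 1), toFrac C g₀ = g := by
  have hg : (g : TotalFrac C) ∈ Submodule.span ℝ (toFrac C '' basisE C k 1) := g.2
  rwa [← Submodule.map_span] at hg

/-- A nontrivial kernel vector of either form pairs to zero with itself; this needs no positivity.
-/
theorem Singular.exists_sq_eq_zero (hd : d < 0) (hw : nodeDir a d e ≠ 0) {k : ℕ} (hk : 1 ≤ k)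
    {L : PolyLE (2 * k) →ₗ[ℝ] ℝ} (hL : Singular L (admissible_Vk a d e hk)) :
    ∃ ε, ∃ hε : ε ≤ 1, ∃ g, ∃ hg : g ∈ Submodule.span ℝ (basisE (curve6 a d e) k ε), g ≠ 0 ∧
      induced L hL.descends ⟨g * g, sq_mem_coordLE hk hε hg⟩ = 0 := by
  obtain ⟨h, hns⟩ := hL
  rw [Nonsingular, not_and_or] at hns
  rcases hns with hns | hns
  · push Not at hns
    obtain ⟨p, ⟨hp, hpI⟩ | ⟨hp, hpI⟩⟩ := hns
    · refine ⟨0, zero_le_one, restr _ (p : MvPolynomial (Fin 2) ℝ), ?_, ?_, ?_⟩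
      · rw [← coordLE_eq_span hd hw hk]
        exact restr_mem p.2
      · exact fun h0 => hpI (Ideal.Quotient.eq_zero_iff_mem.1 h0)
      · refine (induced_apply L h ⟨_, polyLE_mul_mem p.2 p.2⟩).trans ?_
        exact LinearMap.congr_fun (LinearMap.mem_ker.1 hp) p
    -- The inclusion of I in the kernel never fails, because L vanishes on I.
    · refine absurd ?_ hp
      rw [LinearMap.mem_ker]
      ext q
      exact h _ (Ideal.mul_mem_right _ _ hpI)
  · obtain ⟨g, hg, hg0⟩ := Submodule.exists_mem_ne_zero_of_ne_bot hns
    obtain ⟨g₀, hg₀, hgg⟩ := exists_toFrac_eq g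
    refine ⟨1, le_rfl, g₀, hg₀, ?_, ?_⟩
    · rintro rfl
      rw [map_zero] at hgg
      exact hg0 (Subtype.ext hgg.symm)
    · rw [← locForm_apply _ (admissible_Vk a d e hk) g g, LinearMap.mem_ker.1 hg]
      · rfl
      · rw [← hgg]; simp

theorem coordForm_isSymm {C : Set (Fin 2 → ℝ)} {k : ℕ} (Λ : CoordLE C (2 * k) →ₗ[ℝ] ℝ) :
    (coordForm (k := k) Λ).IsSymm :=
  ⟨fun f g => congrArg Λ (Subtype.ext (mul_comm (f : CoordRing C) g))⟩

theorem locForm_isSymm {C : Set (Fin 2 → ℝ)} {k : ℕ} (Λ : CoordLE C (2 * k) →ₗ[ℝ] ℝ)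
    {V : Submodule ℝ (TotalFrac C)} {f : TotalFrac C} (hV : Admissible k V f) :
    (locForm Λ hV).IsSymm := by
  refine ⟨fun g h => ?_⟩
  obtain ⟨r, hr, hrg⟩ := hV g g.2 h h.2
  rw [locForm_apply Λ hV g h ⟨r, hr⟩ hrg,
    locForm_apply Λ hV h g ⟨r, hr⟩ (by rw [mul_comm (h : TotalFrac C)]; exact hrg)]

theorem finiteDimensional_coordLE (C : Set (Fin 2 → ℝ)) (m : ℕ) :
    FiniteDimensional ℝ (CoordLE C m) := by
  unfold CoordLE
  infer_instance

theorem finiteDimensional_Vk (C : Set (Fin 2 → ℝ)) (k : ℕ) : FiniteDimensional ℝ (Vk C k) := by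
  have := finiteDimensional_coordLE C (k + 1)
  have hle : Vk C k ≤ (CoordLE C (k + 1)).map (toFrac C) := by
    rw [Vk, ← Submodule.map_span]
    refine Submodule.map_mono (Submodule.span_le.2 ?_)
    rintro _ (rfl | ⟨i, hi, hik, rfl | rfl⟩ | ⟨j, hj, rfl⟩) <;> exact mon_mem _ (by omega)
  exact Submodule.finiteDimensional_of_le hle

theorem locForm_toFrac {k : ℕ} (hk : 1 ≤ k)
    (Λ : CoordLE (curve6 a d e) (2 * k) →ₗ[ℝ] ℝ) {g : CoordRing (curve6 a d e)}
    (hg : g ∈ Submodule.span ℝ (basisE (curve6 a d e) k 1)) :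
    locForm Λ (admissible_Vk a d e hk) ⟨_, toFrac_mem_Vk.2 hg⟩ ⟨_, toFrac_mem_Vk.2 hg⟩
      = Λ ⟨g * g, sq_mem_coordLE hk le_rfl hg⟩ :=
  locForm_apply _ _ _ _ _ (by simp)

/-- Equality of ranks means that the kernel leaves the hyperplane without y^k, and for a
semidefinite form the kernel consists of the vectors whose square is annihilated. -/
theorem coordForm_rank_eq_iff (hd : d < 0) (hw : nodeDir a d e ≠ 0) {k : ℕ} (hk : 1 ≤ k)
    (Λ : CoordLE (curve6 a d e) (2 * k) →ₗ[ℝ] ℝ) (hs : SquarePositive Λ) :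
    LinearMap.rank (coordForm Λ) = rankOn (coordForm (k := k) Λ) (Uk (curve6 a d e) k) ↔
      ∃ g, ∃ hg : g ∈ Submodule.span ℝ (basisE (curve6 a d e) k 0),
        g ∉ Submodule.span ℝ (basisE (curve6 a d e) k 0 \ {mon (curve6 a d e) 0 k}) ∧
        Λ ⟨g * g, sq_mem_coordLE hk zero_le_one hg⟩ = 0 := by
  constructor
  · intro h
    have := finiteDimensional_coordLE (curve6 a d e) k
    obtain ⟨g, hg, hgU⟩ := LinearMap.BilinForm.exists_mem_ker_notMem_of_rank_eq _ (fun htop => by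
      have : (⟨_, mon_mem (curve6 a d e) (by omega : 0 + k ≤ k)⟩ : CoordLE (curve6 a d e) k)
        ∈ (Uk (curve6 a d e) k).submoduleOf (CoordLE (curve6 a d e) k) := htop ▸ trivial
      exact mon_zero_notMem_span_basisE_diff hd hk zero_le_one this) h
    refine ⟨g, (coordLE_eq_span hd hw hk).le g.2, hgU, ?_⟩
    exact LinearMap.congr_fun (LinearMap.mem_ker.1 hg) g
  · rintro ⟨g, hg, hgU, h0⟩
    have hgC : g ∈ CoordLE (curve6 a d e) k := by rwa [coordLE_eq_span hd hw hk]
    refine LinearMap.BilinForm.rank_eq_rank_restrict _ (coordForm_isSymm Λ) (g := ⟨g, hgC⟩)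
      (LinearMap.BilinForm.mem_ker_of_apply_self_eq_zero _ (coordForm_isSymm Λ) hs h0) ?_
    intro x
    obtain ⟨r, hr⟩ := exists_sub_smul_mem hd hk zero_le_one
      ((coordLE_eq_span hd hw hk).le x.2) hg hgU
    exact ⟨x - r • ⟨g, hgC⟩, hr, r, by simp⟩

/-- The same argument on V^(k), carried between ℝ[C] and its total ring of fractions. -/
theorem locForm_rank_eq_iff (hd : d < 0) {k : ℕ} (hk : 1 ≤ k)
    (Λ : CoordLE (curve6 a d e) (2 * k) →ₗ[ℝ] ℝ)
    (hs : LocSquarePositive Λ (admissible_Vk a d e hk)) :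
    LinearMap.rank (locForm Λ (admissible_Vk a d e hk)) =
        rankOn (locForm Λ (admissible_Vk a d e hk)) (Wk (curve6 a d e) k) ↔
      ∃ g, ∃ hg : g ∈ Submodule.span ℝ (basisE (curve6 a d e) k 1),
        g ∉ Submodule.span ℝ (basisE (curve6 a d e) k 1 \ {mon (curve6 a d e) 0 k}) ∧
        Λ ⟨g * g, sq_mem_coordLE hk le_rfl hg⟩ = 0 := by
  constructor
  · intro h
    have := finiteDimensional_Vk (curve6 a d e) k
    have hmon : mon (curve6 a d e) 0 k ∈ Submodule.span ℝ (basisE (curve6 a d e) k 1) :=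
      Submodule.subset_span (Or.inr (Or.inr ⟨k, le_rfl, rfl⟩))
    obtain ⟨⟨g, hgV⟩, hg, hgU⟩ := LinearMap.BilinForm.exists_mem_ker_notMem_of_rank_eq _
      (fun htop => by
        have : (⟨_, toFrac_mem_Vk.2 hmon⟩ : Vk (curve6 a d e) k)
          ∈ (Wk (curve6 a d e) k).submoduleOf (Vk (curve6 a d e) k) := htop ▸ trivial
        exact mon_zero_notMem_span_basisE_diff hd hk le_rfl (toFrac_mem_Wk.1 this)) h
    obtain ⟨g, hg₀, rfl⟩ := exists_toFrac_eq ⟨g, hgV⟩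
    refine ⟨g, hg₀, fun hU => hgU (toFrac_mem_Wk.2 hU), ?_⟩
    rw [← locForm_toFrac hk Λ hg₀]
    exact LinearMap.congr_fun (LinearMap.mem_ker.1 hg) _
  · rintro ⟨g, hg, hgU, h0⟩
    rw [← locForm_toFrac hk Λ hg] at h0
    refine LinearMap.BilinForm.rank_eq_rank_restrict _ (locForm_isSymm Λ _)
      (LinearMap.BilinForm.mem_ker_of_apply_self_eq_zero _ (locForm_isSymm Λ _) hs h0) ?_
    intro x
    obtain ⟨x₀, hx₀, hx⟩ := exists_toFrac_eq x
    obtain ⟨r, hr⟩ := exists_sub_smul_mem hd hk le_rfl hx₀ hg hgU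
    refine ⟨x - r • ⟨_, toFrac_mem_Vk.2 hg⟩, ?_, r, by simp⟩
    have := toFrac_mem_Wk.2 hr
    rw [map_sub, map_smul, hx] at this
    exact this

end CubicTMP

end

theorem theorem4p4 (a d e : ℝ) (hd : d < 0) (hP : Irreducible (P6 a d e))
    (k : ℕ) (hk : 1 ≤ k) (L : PolyLE (2 * k) →ₗ[ℝ] ℝ)
    (hL : Singular L (admissible_Vk a d e hk)) :
    IsMomentFunctional (curve6 a d e) L ↔
      SquarePositive (induced L hL.descends) ∧
      LocSquarePositive (induced L hL.descends) (admissible_Vk a d e hk) ∧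
      (LinearMap.rank (coordForm (induced L hL.descends)) =
          rankOn (coordForm (induced L hL.descends)) (Uk (curve6 a d e) k) ∨
        LinearMap.rank (locForm (induced L hL.descends) (admissible_Vk a d e hk)) =
          rankOn (locForm (induced L hL.descends) (admissible_Vk a d e hk))
            (Wk (curve6 a d e) k)) := by
  have hw := nodeDir_ne_zero hd hP
  constructor
  · intro hM
    have hs : SquarePositive (induced L hL.descends) := fun f =>
      hM.induced_sq_nonneg hL.descends (g := f) _ rfl
    have hl : LocSquarePositive (induced L hL.descends) (admissible_Vk a d e hk) := by
      rintro ⟨g, hg⟩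
      obtain ⟨g, hg₀, rfl⟩ := exists_toFrac_eq ⟨g, hg⟩
      exact (hM.induced_sq_nonneg hL.descends _ rfl).trans_eq (locForm_toFrac hk _ hg₀).symm
    refine ⟨hs, hl, ?_⟩
    obtain ⟨ε, hε, g, hg, hg0, h0⟩ := hL.exists_sq_eq_zero hd hw hk
    obtain ⟨δ, hδ, g', hg', hgU, hgg⟩ := exists_notMem_of_ne_zero hd hw hk hε hg hg0
    have h1 := hM.induced_sq_eq_zero hL.descends _ ⟨g' * g', sq_mem_coordLE hk hδ hg'⟩
      rfl rfl hgg h0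
    -- The space in which the degree-3k numerator lands decides between (a) and (b).
    obtain rfl | rfl : δ = 0 ∨ δ = 1 := by omega
    · exact Or.inl ((coordForm_rank_eq_iff hd hw hk _ hs).2 ⟨g', hg', hgU, h1⟩)
    · exact Or.inr ((locForm_rank_eq_iff hd hk _ hl).2 ⟨g', hg', hgU, h1⟩)
  · rintro ⟨hs, hl, hr⟩
    have hpos : ∀ ε ≤ 1, ∀ g ∈ Submodule.span ℝ (basisE (curve6 a d e) k ε),
        ∀ f : CoordLE (curve6 a d e) (2 * k), (f : CoordRing (curve6 a d e)) = g * g →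
          0 ≤ induced L hL.descends f := by
      intro ε hε g hg f hf
      obtain rfl : f = ⟨g * g, sq_mem_coordLE hk hε hg⟩ := Subtype.ext hf
      obtain rfl | rfl : ε = 0 ∨ ε = 1 := by omega
      · exact hs ⟨g, by rwa [coordLE_eq_span hd hw hk]⟩
      · exact (hl ⟨_, toFrac_mem_Vk.2 hg⟩).trans_eq (locForm_toFrac hk _ hg)
    rcases hr with hr | hr
    · obtain ⟨g, hg, hgU, h0⟩ := (coordForm_rank_eq_iff hd hw hk _ hs).1 hr
      exact isMomentFunctional_of_sq_eq_zero hd hw hk L _ hpos zero_le_one hg hgU h0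
    · obtain ⟨g, hg, hgU, h0⟩ := (locForm_rank_eq_iff hd hk _ hl).1 hr
      exact isMomentFunctional_of_sq_eq_zero hd hw hk L _ hpos le_rfl hg hgU h0
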